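/- Let $\mathbb K=\mathbb R$ or $\mathbb C$, let $A$ be a solid unital subring of $\mathbb K^{]0,1]}$ (that is, $(r_\varepsilon)\in A$ and $|s_\varepsilon|\le|r_\varepsilon|$ for all $\varepsilon$ imply $(s_\varepsilon)\in A$) and let $I_A$ be a solid ideal of $A$. For $\Omega\subset\mathbb R^n$ open, let $\mathcal H(\Omega)$, respectively $\mathcal J(\Omega)$, be the set of nets $(u_\varepsilon)_{\varepsilon\in]0,1]}$ in $\mathrm C^\infty(\Omega)$ such that for all compact $K\subset\Omega$ and all $l\in\mathbb N$ the net $p_{K,l}(u_\varepsilon)=\sup_{x\in K,|\alpha|\le l}|\partial^\alpha u_\varepsilon(x)|$ is the net of absolute values of an element of $A$, respectively of $I_A$ (for $\mathcal J(\Omega)$, within $\mathcal H(\Omega)$). Let $\mathcal A(\Omega)=\mathcal H(\Omega)/\mathcal J(\Omega)$, with derivatives and restrictions to hyperplanes $\{t=\mathrm{const}\}$ defined on representatives. Fix $d$ and assume that $(\varepsilon^r)_\varepsilon\in A$ for all $r\ge0$, and that for every open $V\subset\mathbb R^d$ every net in $\mathcal J(V)$ converges to $0$ in $\mathcal D'(V)$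 as $\varepsilon\to0$. For $v=[v_\varepsilon]\in\mathcal A(\mathbb R^d)$, the $(a,\mathcal D')$-singular spectrum (with $a_\varepsilon(r)=\varepsilon^r$) is the set $\mathcal S^{(a,\mathcal D')}(v)$ of all $(x,r)\in\mathbb R^d\times[0,\infty[$ for which there are no open neighbourhood $V$ of $x$ and $T\in\mathcal D'(V)$ with $\varepsilon^r v_\varepsilon|_V\to T$ in $\mathcal D'(V)$ (i.e. $\int\varepsilon^r v_\varepsilon\psi\,dx\to\langle T,\psi\rangle$ for all $\psi\in\mathcal D(V)$) as $\varepsilon\to0$. **Proposition.** Let $u_0,u_1\in\mathcal A(\mathbb R^d)$ and let $u\in\mathcal A(\mathbb R^{d+1})$ be a solution of the Cauchy problem for the $d$-dimensional linear wave equation $$\partial_t^2u-\Delta u=0,\qquad u(\cdot,0)=u_0,\qquad \partial_tu(\cdot,0)=u_1$$ (equalities in $\mathcal A(\mathbb R^{d+1})$ and $\mathcal A(\mathbb R^d)$). Let $I\subset[0,\infty[$ be $\varnothing$, or $\{s\ge 0: s<r\}$ or $\{s\ge 0:s\le r\}$ for some $0\le r\le\infty$. If $\mathcal S^{(a,\mathcal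 D')}(u_0)\subset\mathbb R^d\times I$ and $\mathcal S^{(a,\mathcal D')}(u_1)\subset\mathbb R^d\times I$, then $\mathcal S^{(a,\mathcal D')}(u(\cdot,t))\subset\mathbb R^d\times I$ for all $t\in\mathbb R$. -/

import Mathlib

open Set Filter Topology MeasureTheory TopologicalSpace
open scoped NNReal ENNReal ContDiff

noncomputable section

namespace CEP

/-- The index set `]0,1]`; `ε → 0` is the filter `atBot` on it. -/
abbrev Param : Type := Set.Ioc (0 : ℝ) 1

/-- A solid (unital) subring `A` of `𝕜^]0,1]` together with a solid ideal `I` of `A`. -/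
structure SolidPair (𝕜 : Type*) [RCLike 𝕜] where
  A : Subring (Param → 𝕜)
  solid : ∀ s r : Param → 𝕜, r ∈ A → (∀ ε, ‖s ε‖ ≤ ‖r ε‖) → s ∈ A
  I : Ideal A
  solid_ideal : ∀ s r : A, r ∈ I →
    (∀ ε, ‖(s : Param → 𝕜) ε‖ ≤ ‖(r : Param → 𝕜) ε‖) → s ∈ I

/-- The seminorm `p_{K,l}(f)`, the supremum over `K` of all derivatives of `f` of order at most `l`
(derivatives are taken in the open set `Ω ⊇ K`). The operator norm of the `k`-th derivative is used
as the size of the partial derivatives of order `k`; the two differ by constant factors, which do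
not affect membership in solid sets of nets. -/
def ckSeminorm {𝕜 E : Type*} [RCLike 𝕜] [NormedAddCommGroup E] [NormedSpace ℝ E]
    (Ω : Opens E) (K : Set E) (l : ℕ) (f : E → 𝕜) : ℝ :=
  sSup {y | ∃ x ∈ K, ∃ k ≤ l, y = ‖iteratedFDerivWithin ℝ k f Ω x‖}

section Seminorm

variable {𝕜 E : Type*} [RCLike 𝕜] [NormedAddCommGroup E] [NormedSpace ℝ E]
  {Ω : Opens E} {K : Set E} {l : ℕ} {f g : E → 𝕜}

lemma ckSeminorm_nonneg : 0 ≤ ckSeminorm Ω K l f := by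
  apply Real.sSup_nonneg
  rintro y ⟨x, -, k, -, rfl⟩
  exact norm_nonneg _

lemma ckSeminorm_le {C : ℝ} (hC : 0 ≤ C)
    (h : ∀ x ∈ K, ∀ k ≤ l, ‖iteratedFDerivWithin ℝ k f Ω x‖ ≤ C) : ckSeminorm Ω K l f ≤ C := by
  apply Real.sSup_le _ hC
  rintro y ⟨x, hx, k, hk, rfl⟩
  exact h x hx k hk

lemma le_ckSeminorm (hf : ContDiffOn ℝ ∞ f Ω) (hK : IsCompact K) (hKΩ : K ⊆ Ω)
    {x : E} (hx : x ∈ K) {k : ℕ} (hk : k ≤ l) :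
    ‖iteratedFDerivWithin ℝ k f Ω x‖ ≤ ckSeminorm Ω K l f := by
  refine le_csSup ?_ ⟨x, hx, k, hk, rfl⟩
  have : ∀ k : ℕ, ∃ C, ∀ x ∈ K, ‖iteratedFDerivWithin ℝ k f Ω x‖ ≤ C := fun k =>
    hK.exists_bound_of_continuousOn
      ((hf.continuousOn_iteratedFDerivWithin (by exact_mod_cast le_top)
        Ω.isOpen.uniqueDiffOn).mono hKΩ)
  choose C hC using this
  refine ⟨∑ k ∈ Finset.range (l + 1), |C k|, ?_⟩
  rintro y ⟨x, hx, k, hk, rfl⟩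
  exact ((hC k x hx).trans (le_abs_self _)).trans
    (Finset.single_le_sum (f := fun k => |C k|) (fun _ _ => abs_nonneg _)
      (Finset.mem_range.2 (by omega)))

lemma ckSeminorm_add_le (hf : ContDiffOn ℝ ∞ f Ω) (hg : ContDiffOn ℝ ∞ g Ω)
    (hK : IsCompact K) (hKΩ : K ⊆ Ω) :
    ckSeminorm Ω K l (f + g) ≤ ckSeminorm Ω K l f + ckSeminorm Ω K l g := by
  refine ckSeminorm_le (add_nonneg ckSeminorm_nonneg ckSeminorm_nonneg) fun x hx k hk => ?_
  have hk' : (k : WithTop ℕ∞) ≤ ((⊤ : ℕ∞) : WithTop ℕ∞) := by exact_mod_cast le_top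
  rw [iteratedFDerivWithin_add_apply ((hf.of_le hk') x (hKΩ hx)) ((hg.of_le hk') x (hKΩ hx))
    Ω.isOpen.uniqueDiffOn (hKΩ hx)]
  exact (norm_add_le _ _).trans
    (add_le_add (le_ckSeminorm hf hK hKΩ hx hk) (le_ckSeminorm hg hK hKΩ hx hk))

lemma ckSeminorm_mul_le (hf : ContDiffOn ℝ ∞ f Ω) (hg : ContDiffOn ℝ ∞ g Ω)
    (hK : IsCompact K) (hKΩ : K ⊆ Ω) :
    ckSeminorm Ω K l (f * g) ≤ 2 ^ l * (ckSeminorm Ω K l f * ckSeminorm Ω K l g) := by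
  have h0 : 0 ≤ ckSeminorm Ω K l f * ckSeminorm Ω K l g :=
    mul_nonneg ckSeminorm_nonneg ckSeminorm_nonneg
  refine ckSeminorm_le (by positivity) fun x hx k hk => ?_
  have hk' : (k : WithTop ℕ∞) ≤ ((⊤ : ℕ∞) : WithTop ℕ∞) := by exact_mod_cast le_top
  refine (norm_iteratedFDerivWithin_mul_le hf hg Ω.isOpen.uniqueDiffOn (hKΩ hx) hk').trans ?_
  calc _ ≤ ∑ i ∈ Finset.range (k + 1), (k.choose i : ℝ) *
        (ckSeminorm Ω K l f * ckSeminorm Ω K l g) := by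
        refine Finset.sum_le_sum fun i hi => ?_
        rw [mul_assoc]
        have hi' : i ≤ k := by simpa [Nat.lt_succ_iff] using hi
        gcongr
        · exact ckSeminorm_nonneg
        · exact le_ckSeminorm hf hK hKΩ hx (hi'.trans hk)
        · exact le_ckSeminorm hg hK hKΩ hx ((Nat.sub_le _ _).trans hk)
    _ = 2 ^ k * (ckSeminorm Ω K l f * ckSeminorm Ω K l g) := by
        rw [← Finset.sum_mul]
        congr 1
        exact_mod_cast Nat.sum_range_choose k
    _ ≤ _ := by
        gcongr
        norm_num

lemma ckSeminorm_const_le (c : 𝕜) : ckSeminorm Ω K l (fun _ : E => c) ≤ ‖c‖ := by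
  refine ckSeminorm_le (norm_nonneg _) fun x hx k hk => ?_
  rcases Nat.eq_zero_or_pos k with rfl | h
  · simp
  · rw [iteratedFDerivWithin_const_of_ne h.ne']
    simp

lemma ckSeminorm_fderivWithin_le (v : E) (hf : ContDiffOn ℝ ∞ f Ω)
    (hK : IsCompact K) (hKΩ : K ⊆ Ω) :
    ckSeminorm Ω K l (fun x => fderivWithin ℝ f Ω x v) ≤ ‖v‖ * ckSeminorm Ω K (l + 1) f := by
  refine ckSeminorm_le (mul_nonneg (norm_nonneg _) ckSeminorm_nonneg) fun x hx k hk => ?_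
  have hk' : (k : WithTop ℕ∞) ≤ ((⊤ : ℕ∞) : WithTop ℕ∞) := by exact_mod_cast le_top
  have hu := Ω.isOpen.uniqueDiffOn (𝕜 := ℝ)
  have hd : ContDiffOn ℝ ∞ (fderivWithin ℝ f Ω) Ω := hf.fderivWithin hu (by simp)
  refine (norm_iteratedFDerivWithin_clm_apply_const (hd x (hKΩ hx)) hu (hKΩ hx) hk').trans ?_
  gcongr
  rw [norm_iteratedFDerivWithin_fderivWithin hu (hKΩ hx)]
  exact le_ckSeminorm hf hK hKΩ hx (by omega)

end Seminorm

namespace SolidPair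

variable {𝕜 : Type*} [RCLike 𝕜] (P : SolidPair 𝕜)

/-- `|A|`, the nets of absolute values of elements of `A`. -/
def absA : Set (Param → ℝ) := {b | ∃ r ∈ P.A, ∀ ε, b ε = ‖r ε‖}

/-- `|I|`, the nets of absolute values of elements of `I`. -/
def absI : Set (Param → ℝ) := {b | ∃ r ∈ P.I, ∀ ε, b ε = ‖(r : Param → 𝕜) ε‖}

variable {P}

lemma absA_mono {b c : Param → ℝ} (hc : c ∈ P.absA) (hb : ∀ ε, 0 ≤ b ε) (h : ∀ ε, b ε ≤ c ε) :
    b ∈ P.absA := by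
  obtain ⟨r, hr, hrc⟩ := hc
  refine ⟨fun ε => (b ε : 𝕜), P.solid _ r hr fun ε => ?_, fun ε => ?_⟩
  · rw [RCLike.norm_ofReal, abs_of_nonneg (hb ε), ← hrc]
    exact h ε
  · rw [RCLike.norm_ofReal, abs_of_nonneg (hb ε)]

lemma ofReal_mem {b : Param → ℝ} (hb : b ∈ P.absA) : (fun ε => (b ε : 𝕜)) ∈ P.A := by
  obtain ⟨r, hr, hrb⟩ := hb
  exact P.solid _ r hr fun ε => by simp [hrb]

lemma absA_of_mem {b : Param → ℝ} (hb : ∀ ε, 0 ≤ b ε) (h : (fun ε => (b ε : 𝕜)) ∈ P.A) :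
    b ∈ P.absA :=
  ⟨_, h, fun ε => by simp [abs_of_nonneg (hb ε)]⟩

lemma absA_nonneg {b : Param → ℝ} (hb : b ∈ P.absA) (ε : Param) : 0 ≤ b ε := by
  obtain ⟨r, hr, hrb⟩ := hb
  rw [hrb]
  exact norm_nonneg _

lemma absA_add {b c : Param → ℝ} (hb : b ∈ P.absA) (hc : c ∈ P.absA) :
    (fun ε => b ε + c ε) ∈ P.absA := by
  refine absA_of_mem (fun ε => add_nonneg (absA_nonneg hb ε) (absA_nonneg hc ε)) ?_
  convert P.A.add_mem (ofReal_mem hb) (ofReal_mem hc) using 1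
  ext ε
  simp

lemma absA_mul {b c : Param → ℝ} (hb : b ∈ P.absA) (hc : c ∈ P.absA) :
    (fun ε => b ε * c ε) ∈ P.absA := by
  refine absA_of_mem (fun ε => mul_nonneg (absA_nonneg hb ε) (absA_nonneg hc ε)) ?_
  convert P.A.mul_mem (ofReal_mem hb) (ofReal_mem hc) using 1
  ext ε
  simp

lemma absA_const {C : ℝ} (hC : 0 ≤ C) : (fun _ => C) ∈ P.absA := by
  obtain ⟨n, hn⟩ := exists_nat_ge C
  refine absA_mono (c := fun _ => (n : ℝ)) ⟨(n : Param → 𝕜), natCast_mem P.A n, fun ε => ?_⟩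
    (fun _ => hC) (fun _ => hn)
  simp

lemma absI_subset {b : Param → ℝ} (hb : b ∈ P.absI) : b ∈ P.absA := by
  obtain ⟨r, hr, hrb⟩ := hb
  exact ⟨r, r.2, hrb⟩

lemma absI_mono {b c : Param → ℝ} (hc : c ∈ P.absI) (hb : ∀ ε, 0 ≤ b ε) (h : ∀ ε, b ε ≤ c ε) :
    b ∈ P.absI := by
  have hA : (fun ε => (b ε : 𝕜)) ∈ P.A := ofReal_mem (absA_mono (absI_subset hc) hb h)
  obtain ⟨r, hr, hrc⟩ := hc
  refine ⟨⟨_, hA⟩, P.solid_ideal _ r hr fun ε => ?_, fun ε => ?_⟩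
  · simp only [RCLike.norm_ofReal, abs_of_nonneg (hb ε), ← hrc]
    exact h ε
  · simp only [RCLike.norm_ofReal, abs_of_nonneg (hb ε)]

lemma ofReal_mem_ideal {b : Param → ℝ} (hb : b ∈ P.absI) :
    (⟨fun ε => (b ε : 𝕜), ofReal_mem (absI_subset hb)⟩ : P.A) ∈ P.I := by
  obtain ⟨r, hr, hrb⟩ := id hb
  exact P.solid_ideal _ r hr fun ε => by simp [hrb]

lemma absI_add {b c : Param → ℝ} (hb : b ∈ P.absI) (hc : c ∈ P.absI) :
    (fun ε => b ε + c ε) ∈ P.absI := by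
  refine ⟨_, P.I.add_mem (ofReal_mem_ideal hb) (ofReal_mem_ideal hc), fun ε => ?_⟩
  simp only [Subring.coe_add, Pi.add_apply]
  rw [← RCLike.ofReal_add, RCLike.norm_ofReal, abs_of_nonneg (add_nonneg
    (absA_nonneg (absI_subset hb) ε) (absA_nonneg (absI_subset hc) ε))]

lemma absI_mul {b c : Param → ℝ} (hb : b ∈ P.absA) (hc : c ∈ P.absI) :
    (fun ε => b ε * c ε) ∈ P.absI := by
  refine ⟨_, P.I.mul_mem_left ⟨_, ofReal_mem hb⟩ (ofReal_mem_ideal hc), fun ε => ?_⟩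
  simp only [Subring.coe_mul, Pi.mul_apply]
  rw [← RCLike.ofReal_mul, RCLike.norm_ofReal, abs_of_nonneg (mul_nonneg
    (absA_nonneg hb ε) (absA_nonneg (absI_subset hc) ε))]

lemma absI_zero : (fun _ => (0 : ℝ)) ∈ P.absI :=
  ⟨0, P.I.zero_mem, fun ε => by simp⟩

variable (P) {E : Type*} [NormedAddCommGroup E] [NormedSpace ℝ E]

/-- `H_{(A,C^∞,P)}(Ω)`: nets of functions which are smooth on `Ω` and all of whose seminorms
`p_{K,l}`, `K ⊆ Ω` compact, are nets in `|A|`. The elements of `C^∞(Ω)` are given by functions on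
the whole space which are smooth on `Ω`; the values outside `Ω` are irrelevant, as functions which
agree on `Ω` are identified in the quotient below. -/
def moderate (Ω : Opens E) : Subalgebra 𝕜 (Param → E → 𝕜) where
  carrier := {f | (∀ ε, ContDiffOn ℝ ∞ (f ε) Ω) ∧ ∀ K : Set E, IsCompact K → K ⊆ Ω → ∀ l : ℕ,
    (fun ε => ckSeminorm Ω K l (f ε)) ∈ P.absA}
  add_mem' := by
    rintro f g ⟨hf, hf'⟩ ⟨hg, hg'⟩
    refine ⟨fun ε => (hf ε).add (hg ε), fun K hK hKΩ l => ?_⟩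
    exact absA_mono (absA_add (hf' K hK hKΩ l) (hg' K hK hKΩ l)) (fun ε => ckSeminorm_nonneg)
      (fun ε => ckSeminorm_add_le (hf ε) (hg ε) hK hKΩ)
  mul_mem' := by
    rintro f g ⟨hf, hf'⟩ ⟨hg, hg'⟩
    refine ⟨fun ε => (hf ε).mul (hg ε), fun K hK hKΩ l => ?_⟩
    exact absA_mono (absA_mul (absA_const (C := 2 ^ l) (by positivity))
      (absA_mul (hf' K hK hKΩ l) (hg' K hK hKΩ l))) (fun ε => ckSeminorm_nonneg)
      (fun ε => ckSeminorm_mul_le (hf ε) (hg ε) hK hKΩ)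
  algebraMap_mem' := by
    intro c
    refine ⟨fun ε => contDiffOn_const, fun K hK hKΩ l => ?_⟩
    exact absA_mono (absA_const (norm_nonneg c)) (fun ε => ckSeminorm_nonneg)
      (fun ε => ckSeminorm_const_le c)

/-- `J_{(I,C^∞,P)}(Ω)`: the nets all of whose seminorms are nets in `|I|`. -/
def negligible (Ω : Opens E) : Ideal (P.moderate Ω) where
  carrier := {f | ∀ K : Set E, IsCompact K → K ⊆ Ω → ∀ l : ℕ,
    (fun ε => ckSeminorm Ω K l ((f : Param → E → 𝕜) ε)) ∈ P.absI}
  add_mem' := by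
    intro f g hf hg K hK hKΩ l
    exact absI_mono (absI_add (hf K hK hKΩ l) (hg K hK hKΩ l)) (fun ε => ckSeminorm_nonneg)
      (fun ε => ckSeminorm_add_le (f.2.1 ε) (g.2.1 ε) hK hKΩ)
  zero_mem' := by
    intro K hK hKΩ l
    exact absI_mono absI_zero (fun ε => ckSeminorm_nonneg)
      (fun ε => (ckSeminorm_const_le (0 : 𝕜)).trans (by simp))
  smul_mem' := by
    intro f g hg K hK hKΩ l
    exact absI_mono (absI_mul (absA_const (C := 2 ^ l) (by positivity))
      (absI_mul (f.2.2 K hK hKΩ l) (hg K hK hKΩ l))) (fun ε => ckSeminorm_nonneg)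
      (fun ε => ckSeminorm_mul_le (f.2.1 ε) (g.2.1 ε) hK hKΩ)

/-- The algebra `𝒜(Ω) = H(Ω) / J(Ω)` of generalized functions. -/
abbrev GenFun (Ω : Opens E) := P.moderate Ω ⧸ P.negligible Ω

variable {P} {Ω : Opens E}

/-- The class `[f_ε]`. -/
def cls (f : P.moderate Ω) : P.GenFun Ω := Ideal.Quotient.mk (P.negligible Ω) f

/-- The partial derivative in direction `v` of a net, taken for each `ε`. -/
def netDeriv (v : E) (f : P.moderate Ω) : P.moderate Ω :=
  ⟨fun ε x => fderivWithin ℝ ((f : Param → E → 𝕜) ε) Ω x v, by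
    refine ⟨fun ε => ?_, fun K hK hKΩ l => ?_⟩
    · exact ((f.2.1 ε).fderivWithin Ω.isOpen.uniqueDiffOn (m := ∞) (by simp)).clm_apply
        contDiffOn_const
    · exact absA_mono (absA_mul (absA_const (norm_nonneg v)) (f.2.2 K hK hKΩ (l + 1)))
        (fun ε => ckSeminorm_nonneg) (fun ε => ckSeminorm_fderivWithin_le v (f.2.1 ε) hK hKΩ)⟩

lemma netDeriv_sub_mem (v : E) (f g : P.moderate Ω) (h : f - g ∈ P.negligible Ω) :
    netDeriv v f - netDeriv v g ∈ P.negligible Ω := by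
  have key : netDeriv v f - netDeriv v g - netDeriv v (f - g) ∈ P.negligible Ω := by
    intro K hK hKΩ l
    refine absI_mono absI_zero (fun ε => ckSeminorm_nonneg) fun ε => ckSeminorm_le le_rfl ?_
    intro x hx k hk
    have h0 : EqOn (((netDeriv v f - netDeriv v g - netDeriv v (f - g) : P.moderate Ω) :
        Param → E → 𝕜) ε) (fun _ => 0) Ω := by
      intro y hy
      have hu := Ω.isOpen.uniqueDiffOn (𝕜 := ℝ) y hy
      have hf := (f.2.1 ε).differentiableOn (by simp) y hy
      have hg := (g.2.1 ε).differentiableOn (by simp) y hy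
      have := fderivWithin_sub hu hf hg
      simp [netDeriv, this]
    rw [iteratedFDerivWithin_congr h0 (hKΩ hx)]
    simp
  have key2 : netDeriv v (f - g) ∈ P.negligible Ω := fun K hK hKΩ l =>
    absI_mono (absI_mul (absA_const (norm_nonneg v)) (h K hK hKΩ (l + 1)))
        (fun ε => ckSeminorm_nonneg)
        (fun ε => ckSeminorm_fderivWithin_le v ((f - g).2.1 ε) hK hKΩ)
  simpa using (P.negligible Ω).add_mem key key2

/-- The partial derivative `∂_v : 𝒜(Ω) → 𝒜(Ω)`, `∂_v [f_ε] = [∂_v f_ε]`. -/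
def pderiv (v : E) : P.GenFun Ω → P.GenFun Ω :=
  Quotient.map' (netDeriv v) fun f g h => by
    rw [Submodule.quotientRel_def] at h ⊢
    exact netDeriv_sub_mem v f g h

lemma pderiv_cls (v : E) (f : P.moderate Ω) : pderiv v (cls f) = cls (netDeriv v f) := rfl

lemma ckSeminorm_slice_le {f : E × ℝ → 𝕜} (hf : ContDiffOn ℝ ∞ f (⊤ : Opens (E × ℝ))) (t : ℝ)
    {K : Set E} (hK : IsCompact K) (l : ℕ) :
    ckSeminorm (⊤ : Opens E) K l (fun x => f (x, t)) ≤
      ckSeminorm (⊤ : Opens (E × ℝ)) (K ×ˢ {t}) l f := by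
  refine ckSeminorm_le ckSeminorm_nonneg fun x hx k hk => ?_
  have hk' : (k : WithTop ℕ∞) ≤ ((⊤ : ℕ∞) : WithTop ℕ∞) := by exact_mod_cast le_top
  refine le_trans ?_ (le_ckSeminorm hf (hK.prod isCompact_singleton) (by simp)
    (Set.mk_mem_prod hx rfl) hk)
  have hf' : ContDiff ℝ ∞ f := by simpa [contDiffOn_univ] using hf
  have hft : ContDiff ℝ ∞ (fun z : E × ℝ => f (z + (0, t))) :=
    hf'.comp (contDiff_id.add contDiff_const)
  have e : (fun x : E => f (x, t)) =
      (fun z : E × ℝ => f (z + (0, t))) ∘ ContinuousLinearMap.inl ℝ E ℝ := by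
    ext y
    simp
  simp only [Opens.coe_top, iteratedFDerivWithin_univ]
  rw [e, ContinuousLinearMap.iteratedFDeriv_comp_right _ hft x hk', iteratedFDeriv_comp_add_right]
  refine (ContinuousMultilinearMap.norm_compContinuousLinearMap_le _ _).trans ?_
  have h1 : ‖ContinuousLinearMap.inl ℝ E ℝ‖ ≤ 1 := ContinuousLinearMap.norm_inl_le_one ℝ E ℝ
  have h2 : ∏ _i : Fin k, ‖ContinuousLinearMap.inl ℝ E ℝ‖ ≤ 1 :=
    Finset.prod_le_one (fun _ _ => norm_nonneg _) fun _ _ => h1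
  simpa using mul_le_mul_of_nonneg_left h2 (norm_nonneg (iteratedFDeriv ℝ k f (x, t)))

/-- The restriction of a net on `E × ℝ` to the slice at time `t`. -/
def netSlice (t : ℝ) (f : P.moderate (⊤ : Opens (E × ℝ))) : P.moderate (⊤ : Opens E) :=
  ⟨fun ε x => (f : Param → E × ℝ → 𝕜) ε (x, t), by
    refine ⟨fun ε => ?_, fun K hK hKΩ l => ?_⟩
    · exact (f.2.1 ε).comp (contDiff_id.prodMk contDiff_const).contDiffOn (by intro x _; simp)
    · exact absA_mono (f.2.2 (K ×ˢ {t}) (hK.prod isCompact_singleton) (by simp) l)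
        (fun ε => ckSeminorm_nonneg) (fun ε => ckSeminorm_slice_le (f.2.1 ε) t hK l)⟩

lemma netSlice_sub_mem (t : ℝ) (f g : P.moderate (⊤ : Opens (E × ℝ)))
    (h : f - g ∈ P.negligible ⊤) : netSlice t f - netSlice t g ∈ P.negligible ⊤ := by
  have e : netSlice t f - netSlice t g = netSlice t (f - g) := rfl
  rw [e]
  intro K hK hKΩ l
  exact absI_mono (h (K ×ˢ {t}) (hK.prod isCompact_singleton) (by simp) l)
    (fun ε => ckSeminorm_nonneg) (fun ε => ckSeminorm_slice_le ((f - g).2.1 ε) t hK l)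

/-- The restriction `u ↦ u(·,t)`, `𝒜(E × ℝ) → 𝒜(E)`. -/
def slice (t : ℝ) : P.GenFun (⊤ : Opens (E × ℝ)) → P.GenFun (⊤ : Opens E) :=
  Quotient.map' (netSlice t) fun f g h => by
    rw [Submodule.quotientRel_def] at h ⊢
    exact netSlice_sub_mem t f g h

lemma slice_cls (t : ℝ) (f : P.moderate (⊤ : Opens (E × ℝ))) :
    slice t (cls f) = cls (netSlice t f) := rfl

end SolidPair

/-- `ℝ^d`. -/
abbrev Rd (d : ℕ) : Type := EuclideanSpace ℝ (Fin d)

/-- The scale `a_ε(r) = ε^r`. -/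
def scale (r : ℝ≥0) (ε : Param) : ℝ := (ε : ℝ) ^ (r : ℝ)

/-- `v_ε → T` in `𝒟'(V)` as `ε → 0`: convergence when tested on each test function on `V`. -/
def TendstoDistr {𝕜 : Type*} [RCLike 𝕜] {d : ℕ} (V : Opens (Rd d)) (v : Param → Rd d → 𝕜)
    (T : Distribution V 𝕜 ⊤) : Prop :=
  ∀ ψ : TestFunction V ℝ ⊤, Tendsto (fun ε : Param => ∫ x, ψ x • v ε x) atBot (𝓝 (T ψ))

namespace SolidPair

variable {𝕜 : Type*} [RCLike 𝕜] {P : SolidPair 𝕜} {d : ℕ} {Ω : Opens (Rd d)}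

/-- `N_x(u)`: the `r ≥ 0` for which `ε^r u_ε` converges in `𝒟'(V)` for some open neighbourhood `V`
of `x`. -/
def regularExponents (u : P.GenFun Ω) (x : Rd d) : Set ℝ≥0 :=
  {r | ∃ f : P.moderate Ω, cls f = u ∧ ∃ V : Opens (Rd d), x ∈ V ∧ V ≤ Ω ∧
    ∃ T : Distribution V 𝕜 ⊤,
      TendstoDistr V (fun ε y => scale r ε • (f : Param → Rd d → 𝕜) ε y) T}

/-- The `(a, 𝒟')`-singular spectrum of `u ∈ 𝒜(Ω)`. -/
def singularSpectrum (u : P.GenFun Ω) : Set (Rd d × ℝ≥0) :=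
  {p | p.1 ∈ Ω ∧ p.2 ∉ regularExponents u p.1}

/-- `u ∈ 𝒜(ℝ^d × ℝ)` solves `∂_t² u - Δu = 0`, `u(·,0) = u₀`, `∂_t u(·,0) = u₁`, all equalities
being equalities in the algebras `𝒜(ℝ^d × ℝ)` and `𝒜(ℝ^d)`. -/
structure IsWaveSolution (u : P.GenFun (⊤ : Opens (Rd d × ℝ)))
    (u₀ u₁ : P.GenFun (⊤ : Opens (Rd d))) : Prop where
  wave : pderiv (0, 1) (pderiv (0, 1) u) -
    ∑ i : Fin d, pderiv (EuclideanSpace.single i 1, 0)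
      (pderiv (EuclideanSpace.single i 1, 0) u) = 0
  init : slice 0 u = u₀
  init_deriv : slice 0 (pderiv (0, 1) u) = u₁

end SolidPair

end CEP

end

open scoped Distributions

noncomputable section

namespace CEP

/-! ### The space of test functions supported in a compact set is barrelled -/

section Complete

variable {E F : Type*} [NormedAddCommGroup E] [NormedSpace ℝ E] [NormedAddCommGroup F]
  [NormedSpace ℝ F] {K : Compacts E}

/-! The proof is by duality. Let `f` be a representative of `u`, let `ψ` be a test function, and let
`W` be the classical solution of the wave equation with `W = 0` and `∂_t W = ψ` at time `t`. Put
`B_ε(s) = ∫ (W ∂_t f_ε - ∂_t W f_ε)(x, s) dx`. By Green's identity, `B_ε' = ∫ W □f_ε`. Since `u`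
solves the equation in the algebra, `□f_ε` is negligible, so it tends to `0` uniformly on compact
sets and `B_ε(t) - B_ε(0) → 0`. As `B_ε(t) = -∫ ψ f_ε(·, t)`, multiplying by `ε^r ≤ 1` shows that
`ε^r f_ε(·, t)` converges on `ψ` as soon as `ε^r f_ε(·, 0)` and `ε^r ∂_t f_ε(·, 0)` converge on the
test functions `∂_t W(·, 0)` and `W(·, 0)`. If `r ∉ I`, the data converge near every point, hence on
every test function by a partition of unity (`exists_tendsto_of_regular`). The limits on all `ψ`
form a distribution by Banach–Steinhaus (`exists_tendstoDistr`).

The solution `W` must be smooth with compact support in space (`exists_solvesWave`). Its Fourier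
transform in `x` is `ψ̂(ξ) sin(2π|ξ|t)/(2π|ξ|)`, up to a shift in time. Writing the multiplier as
`(t/2) ∫_{-1}^{1} exp(2πiσ|ξ|t) dσ` makes it a Fourier integral over the solid light cone, which can
be differentiated freely. Compact support comes from a weighted energy estimate
(`eq_zero_of_lt_norm`), and `exists_green_bound` makes the duality uniform in `ε`. -/

lemma isClosed_range_structureMaps :
    IsClosed (range (ContinuousLinearMap.pi (ContDiffMapSupportedIn.structureMapCLM ℝ ⊤) :
      𝓓^{⊤}_{K}(E, F) →L[ℝ] Π i : ℕ, BoundedContinuousFunction E (E [×i]→L[ℝ] F))) := by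
  -- The target is a countable product of normed spaces, hence metrizable, so sequences suffice.
  refine IsSeqClosed.isClosed fun u g hu hg => ?_
  choose f hf using hu
  rw [tendsto_pi_nhds] at hg
  have hcoe : ∀ n i x, u n i x = iteratedFDeriv ℝ i (f n) x := fun n i x => by
    rw [← hf n]
    simp [ContDiffMapSupportedIn.structureMapCLM_apply]
  have hunif : ∀ i, TendstoUniformly (fun n x => u n i x) (g i) atTop := fun i =>
    BoundedContinuousFunction.tendsto_iff_tendstoUniformly.1 (hg i)
  have hpt : ∀ i x, Tendsto (fun n => u n i x) atTop (𝓝 (g i x)) := fun i x =>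
    (hunif i).tendsto_at x
  set g₀ : E → F := fun x => g 0 x 0 with hg₀
  -- Uniform convergence in order `m + 1` permits differentiating the limit in order `m`, so the
  -- limits are the successive derivatives of `g₀`.
  have htaylor : HasFTaylorSeriesUpTo ∞ g₀ (fun x i => g i x) := by
    refine ⟨fun x => rfl, fun m _ x => ?_, fun m _ => (g m).continuous⟩
    have hU : TendstoUniformly (fun n x => (u n (m + 1) x).curryLeft)
        (fun x => (g (m + 1) x).curryLeft) atTop :=
      (continuousMultilinearCurryLeftEquiv ℝ (fun _ : Fin (m + 1) => E)
        F).isometry.uniformContinuous.comp_tendstoUniformly (hunif (m + 1))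
    refine hasFDerivAt_of_tendstoUniformly hU (fun n y => ?_) (fun y => hpt m y) x
    have h1 : (fun y => u n m y) = iteratedFDeriv ℝ m (f n) := funext (hcoe n m)
    have hd : DifferentiableAt ℝ (iteratedFDeriv ℝ m (f n)) y :=
      ((f n).contDiff.differentiable_iteratedFDeriv (m := m)
        (by exact_mod_cast ENat.natCast_lt_top m)) y
    rw [hcoe]
    change HasFDerivAt (fun y => u n m y) _ y
    rw [h1]
    exact hd.hasFDerivAt
  have hsm : ContDiff ℝ ∞ g₀ := htaylor.contDiff
  have hsupp : EqOn g₀ 0 (K : Set E)ᶜ := fun x hx => by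
    have h0 : ∀ n, u n 0 x 0 = 0 := fun n => by
      rw [hcoe, iteratedFDeriv_zero_apply]
      exact (f n).zero_on_compl hx
    have h1 : Tendsto (fun n => u n 0 x 0) atTop (𝓝 (g 0 x 0)) :=
      ((ContinuousMultilinearMap.apply ℝ (fun _ : Fin 0 => E) F 0).continuous.tendsto _).comp
        (hpt 0 x)
    simp only [h0] at h1
    exact (tendsto_nhds_unique h1 tendsto_const_nhds)
  refine ⟨⟨g₀, hsm, hsupp⟩, ?_⟩
  ext1 i
  ext1 x
  have := htaylor.eq_iteratedFDeriv (m := i) (by exact_mod_cast le_top) x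
  simp only [ContinuousLinearMap.coe_pi']
  rw [ContDiffMapSupportedIn.structureMapCLM_apply]
  simp only [le_top, ↓reduceIte]
  exact this.symm

/-- Recording all derivatives embeds the space as a closed subspace of a countable product of Banach
spaces. It is therefore completely metrizable, hence Baire, hence barrelled, as Banach–Steinhaus
requires. -/
instance barrelledSpace_supportedIn [CompleteSpace F] : BarrelledSpace ℝ 𝓓^{⊤}_{K}(E, F) := by
  have h := (ContDiffMapSupportedIn.isUniformEmbedding_pi_structureMapCLM ℝ
    (n := ⊤) (K := K) (E := E) (F := F))
  have hc : IsClosedEmbedding _ := ⟨h.isEmbedding, isClosed_range_structureMaps⟩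
  have := hc.IsCompletelyPseudoMetrizableSpace
  infer_instance

end Complete

/-! ### Limits of distributions -/

section Limits

variable {𝕜 : Type*} [RCLike 𝕜] {d : ℕ}

/-- A net of continuous functions which converges on every test function converges to a
distribution. -/
lemma exists_tendstoDistr (V : Opens (Rd d)) (v : Param → Rd d → 𝕜) (hv : ∀ ε, Continuous (v ε))
    (h : ∀ ψ : TestFunction V ℝ ⊤, ∃ l, Tendsto (fun ε : Param => ∫ x, ψ x • v ε x) atBot (𝓝 l)) :
    ∃ T : Distribution V 𝕜 ⊤, TendstoDistr V v T := by
  choose T hT using h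
  let B : ℝ →L[ℝ] 𝕜 →L[ℝ] 𝕜 := ContinuousLinearMap.lsmul ℝ ℝ
  let g : Param → TestFunction V ℝ ⊤ →L[ℝ] 𝕜 := fun ε =>
    TestFunction.integralAgainstBilinCLM B volume (v ε)
  have hg : ∀ ε ψ, g ε ψ = ∫ x, ψ x • v ε x := fun ε ψ =>
    TestFunction.integralAgainstBilinCLM_eq_integral
      ((hv ε).locallyIntegrable.locallyIntegrableOn _)
  have hlim : Tendsto (fun ε ψ => g ε ψ) atBot (𝓝 T) :=
    tendsto_pi_nhds.2 fun ψ => by simpa only [hg] using hT ψ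
  let TL : TestFunction V ℝ ⊤ →ₗ[ℝ] 𝕜 :=
    linearMapOfTendsto T (fun ε => (g ε).toLinearMap) hlim
  -- Continuity is checked on functions supported in a fixed compact set. There Banach–Steinhaus
  -- applies, because `atBot` on `]0,1]` is countably generated and sequences of parameters suffice.
  have hcont : Continuous TL := by
    rw [TestFunction.continuous_iff_continuous_comp]
    intro K hK
    let gK : Param → 𝓓^{⊤}_{K}(Rd d, ℝ) →L[ℝ] 𝕜 := fun ε =>
      (g ε).comp (TestFunction.ofSupportedInCLM ℝ hK)
    have hlimK : Tendsto (fun ε f => gK ε f) atBot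
        (𝓝 (fun f => T (TestFunction.ofSupportedIn hK f))) :=
      tendsto_pi_nhds.2 fun f => tendsto_pi_nhds.1 hlim _
    exact (continuousLinearMapOfTendsto gK hlimK).continuous
  exact ⟨⟨TL, hcont⟩, hT⟩

open scoped Manifold in
/-- Convergence on all test functions is a local property. -/
lemma exists_tendsto_of_locally (v : Param → Rd d → 𝕜) (hv : ∀ ε, Continuous (v ε))
    (h : ∀ x : Rd d, ∃ V : Opens (Rd d), x ∈ V ∧ ∀ ψ : TestFunction V ℝ ⊤,
      ∃ l, Tendsto (fun ε : Param => ∫ x, ψ x • v ε x) atBot (𝓝 l))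
    (ψ : Rd d → ℝ) (hψ : ContDiff ℝ ∞ ψ) (hψc : HasCompactSupport ψ) :
    ∃ l, Tendsto (fun ε : Param => ∫ x, ψ x • v ε x) atBot (𝓝 l) := by
  choose V hxV hV using h
  obtain ⟨ρ, hρ⟩ := SmoothPartitionOfUnity.exists_isSubordinate 𝓘(ℝ, Rd d) isClosed_univ
    (fun x => (V x : Set (Rd d))) (fun x => (V x).isOpen) (fun x _ => mem_iUnion.2 ⟨x, hxV x⟩)
  -- Local finiteness and compactness leave finitely many pieces of `ψ`, so their limits can be
  -- added.
  have hfin : {i | (Function.support (ρ i) ∩ tsupport ψ).Nonempty}.Finite :=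
    ρ.locallyFinite.finite_nonempty_inter_compact hψc
  set s := hfin.toFinset with hs
  have hρs : ∀ i, ContDiff ℝ ∞ (ρ i) := fun i => (ρ i).contMDiff.contDiff
  have hsum : ∀ x, ψ x = ∑ i ∈ s, ρ i x * ψ x := fun x => by
    by_cases hx : ψ x = 0
    · simp [hx]
    · have h1 := ρ.sum_eq_one (mem_univ x)
      rw [finsum_eq_sum_of_support_subset (s := s) _ ?_] at h1
      · rw [← Finset.sum_mul, h1, one_mul]
      · intro i hi
        simp only [hs, Finite.coe_toFinset, mem_ofPred_eq]
        exact ⟨x, hi, subset_tsupport _ hx⟩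
  have hl : ∀ i, ∃ l, Tendsto (fun ε : Param => ∫ x, (ρ i x * ψ x) • v ε x) atBot (𝓝 l) :=
    fun i => hV i ⟨fun x => ρ i x * ψ x, (hρs i).mul hψ, hψc.mul_left,
      (closure_mono (Function.support_mul_subset_left _ _)).trans (hρ i)⟩
  choose l hl using hl
  refine ⟨∑ i ∈ s, l i, (tendsto_finsetSum s fun i _ => hl i).congr fun ε => ?_⟩
  rw [← integral_finsetSum]
  · simp_rw [← Finset.sum_smul, ← hsum]
  · intro i _
    refine Continuous.integrable_of_hasCompactSupport ?_ ?_
    · exact ((hρs i).continuous.mul hψ.continuous).smul (hv ε)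
    · have hc : HasCompactSupport (fun x => ρ i x * ψ x) := hψc.mul_left
      exact hc.smul_right (f' := v ε)

end Limits

/-! ### Integrals over time slices -/

section Slices

variable {d : ℕ} {G H : Type*} [NormedAddCommGroup G] [NormedAddCommGroup H]

/-- The unit vector in the direction of time. -/
def timeVec : Rd d × ℝ := (0, 1)

/-- The `i`-th unit vector of space. -/
def spaceVec (i : Fin d) : Rd d × ℝ := (EuclideanSpace.single i 1, 0)

/-- The restriction of `F` to each bounded time interval has bounded support. -/
def SpatiallyCompact (F : Rd d × ℝ → G) : Prop :=
  ∀ T : ℝ, ∃ R : ℝ, ∀ x t, |t| ≤ T → R < ‖x‖ → F (x, t) = 0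

lemma SpatiallyCompact.mono {F : Rd d × ℝ → G} {F' : Rd d × ℝ → H} (hF : SpatiallyCompact F)
    (h : ∀ z, F z = 0 → F' z = 0) : SpatiallyCompact F' := fun T => by
  obtain ⟨R, hR⟩ := hF T
  exact ⟨R, fun x t ht hx => h _ (hR x t ht hx)⟩

lemma SpatiallyCompact.sub {F F' : Rd d × ℝ → G} (hF : SpatiallyCompact F)
    (hF' : SpatiallyCompact F') : SpatiallyCompact (fun z => F z - F' z) := fun T => by
  obtain ⟨R, hR⟩ := hF T
  obtain ⟨R', hR'⟩ := hF' T
  refine ⟨max R R', fun x t ht hx => ?_⟩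
  simp [hR x t ht ((le_max_left _ _).trans_lt hx), hR' x t ht ((le_max_right _ _).trans_lt hx)]

lemma SpatiallyCompact.hasCompactSupport_slice {F : Rd d × ℝ → G} (hF : SpatiallyCompact F)
    (t : ℝ) : HasCompactSupport fun x => F (x, t) := by
  obtain ⟨R, hR⟩ := hF |t|
  refine HasCompactSupport.intro (isCompact_closedBall (0 : Rd d) R) fun x hx => hR x t le_rfl ?_
  simpa using hx

lemma SpatiallyCompact.integrable_slice {F : Rd d × ℝ → G} (hF : SpatiallyCompact F)
    (hc : Continuous F) (t : ℝ) : Integrable fun x => F (x, t) :=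
  Continuous.integrable_of_hasCompactSupport (by fun_prop) (hF.hasCompactSupport_slice t)

variable [NormedSpace ℝ G]

/-- The derivative of a function on space-time in the direction `v`. -/
def dirDeriv (v : Rd d × ℝ) (F : Rd d × ℝ → G) (z : Rd d × ℝ) : G := fderiv ℝ F z v

lemma SpatiallyCompact.dirDeriv {F : Rd d × ℝ → G} (hF : SpatiallyCompact F) (v : Rd d × ℝ) :
    SpatiallyCompact (dirDeriv v F) := fun T => by
  -- The margin `1` in time makes `F` vanish on a whole neighbourhood of `(x, t)`, not only on the
  -- slab.
  obtain ⟨R, hR⟩ := hF (T + 1)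
  refine ⟨R, fun x t ht hx => ?_⟩
  have ho : IsOpen {z : Rd d × ℝ | |z.2| < T + 1 ∧ R < ‖z.1‖} :=
    (isOpen_lt (continuous_abs.comp continuous_snd) continuous_const).and
      (isOpen_lt continuous_const continuous_fst.norm)
  have he : F =ᶠ[𝓝 (x, t)] fun _ => 0 := by
    filter_upwards [ho.mem_nhds (show (x, t) ∈ {z : Rd d × ℝ | |z.2| < T + 1 ∧ R < ‖z.1‖} from
      ⟨by simp only; linarith, hx⟩)] with z hz
    exact hR z.1 z.2 hz.1.le hz.2
  simp [CEP.dirDeriv, he.fderiv_eq]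

lemma _root_.ContDiff.dirDeriv {F : Rd d × ℝ → G} {n m : ℕ∞ω} (hF : ContDiff ℝ n F)
    (h : m + 1 ≤ n) (v : Rd d × ℝ) : ContDiff ℝ m (dirDeriv v F) :=
  (hF.fderiv_right h).clm_apply contDiff_const

lemma hasDerivAt_time {F : Rd d × ℝ → G} (hF : Differentiable ℝ F) (x : Rd d) (t : ℝ) :
    HasDerivAt (fun s => F (x, s)) (dirDeriv timeVec F (x, t)) t := by
  have h := (hF (x, t)).hasFDerivAt.comp_hasDerivAt t
    ((hasDerivAt_const t x).prodMk (hasDerivAt_id t))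
  simpa [dirDeriv, timeVec, Function.comp_def] using h

lemma fderiv_slice {F : Rd d × ℝ → G} (hF : Differentiable ℝ F) (x v : Rd d) (t : ℝ) :
    fderiv ℝ (fun y => F (y, t)) x v = dirDeriv (v, 0) F (x, t) := by
  have h := (hF (x, t)).hasFDerivAt.comp (f := fun y => (y, t)) x
    ((hasFDerivAt_id x).prodMk (hasFDerivAt_const t x))
  rw [Function.comp_def] at h
  rw [h.fderiv]
  simp [dirDeriv]

lemma integral_dirDeriv_space [CompleteSpace G] {F : Rd d × ℝ → G} (hF : ContDiff ℝ 1 F)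
    (hc : SpatiallyCompact F) (v : Rd d) (t : ℝ) : ∫ x, dirDeriv (v, 0) F (x, t) = 0 := by
  have hd := hF.differentiable one_ne_zero
  have hD : Continuous (dirDeriv (v, 0) F) := (hF.dirDeriv (m := 0) (by simp) _).continuous
  -- Integration by parts against the constant `1`, whose derivative is zero.
  have h := integral_smul_fderiv_eq_neg_fderiv_smul_of_integrable (μ := volume)
    (f := fun _ : Rd d => (1 : ℝ)) (g := fun y => F (y, t)) (v := v)
    (by simp) (by simpa [fderiv_slice hd] using (hc.dirDeriv _).integrable_slice hD t)
    (by simpa using hc.integrable_slice hF.continuous t) (by simp)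
    (fun x _ => (hd.comp (differentiable_id.prodMk (differentiable_const t))) x)
  simpa [fderiv_slice hd] using h

lemma hasDerivAt_integral_slice [CompleteSpace G] {F : Rd d × ℝ → G} (hF : ContDiff ℝ 1 F)
    (hc : SpatiallyCompact F) (t : ℝ) :
    HasDerivAt (fun s => ∫ x, F (x, s)) (∫ x, dirDeriv timeVec F (x, t)) t := by
  have hd := hF.differentiable one_ne_zero
  have hD : Continuous (dirDeriv timeVec F) := (hF.dirDeriv (m := 0) (by simp) _).continuous
  -- For times within `1` of `t` the derivative is supported in one ball and bounded there; this
  -- supplies the dominating function.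
  obtain ⟨R, hR⟩ := (hc.dirDeriv timeVec) (|t| + 1)
  obtain ⟨C, hC⟩ := ((isCompact_closedBall (0 : Rd d) R).prod
    (isCompact_Icc (a := -(|t| + 1)) (b := |t| + 1))).exists_bound_of_continuousOn hD.continuousOn
  refine (hasDerivAt_integral_of_dominated_loc_of_deriv_le (μ := volume)
    (F := fun s x => F (x, s)) (F' := fun s x => dirDeriv timeVec F (x, s))
    (bound := (Metric.closedBall (0 : Rd d) R).indicator fun _ => C)
    (Metric.ball_mem_nhds t one_pos)
    (Eventually.of_forall fun s => (hc.integrable_slice hF.continuous s).1)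
    (hc.integrable_slice hF.continuous t) ((hc.dirDeriv _).integrable_slice hD t).1
    (Eventually.of_forall fun x s hs => ?_) ?_
    (Eventually.of_forall fun x s _ => hasDerivAt_time hd x s)).2
  · have hs' : |s| ≤ |t| + 1 := by
      have := abs_sub_abs_le_abs_sub s t
      rw [Metric.mem_ball, Real.dist_eq] at hs
      linarith
    by_cases hx : x ∈ Metric.closedBall (0 : Rd d) R
    · rw [indicator_of_mem hx]
      exact hC (x, s) ⟨hx, abs_le.1 hs'⟩
    · rw [indicator_of_notMem hx, hR x s hs' (by simpa using hx), norm_zero]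
  · rw [integrable_indicator_iff Metric.isClosed_closedBall.measurableSet]
    exact integrableOn_const (isCompact_closedBall (0 : Rd d) R).measure_lt_top.ne

/-- The balance law for a density `F` with fluxes `J i`. -/
lemma hasDerivAt_integral_slice_flux [CompleteSpace G] {F : Rd d × ℝ → G}
    {J : Fin d → Rd d × ℝ → G} (hF : ContDiff ℝ 1 F) (hc : SpatiallyCompact F)
    (hJ : ∀ i, ContDiff ℝ 1 (J i)) (hJc : ∀ i, SpatiallyCompact (J i)) (t : ℝ) :
    HasDerivAt (fun s => ∫ x, F (x, s))
      (∫ x, (dirDeriv timeVec F (x, t) - ∑ i, dirDeriv (spaceVec i) (J i) (x, t))) t := by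
  have hD : ∀ v, Continuous (dirDeriv v F) := fun v =>
    (hF.dirDeriv (m := 0) (by simp) _).continuous
  have hDJ : ∀ i v, Continuous (dirDeriv v (J i)) := fun i v =>
    ((hJ i).dirDeriv (m := 0) (by simp) _).continuous
  have hint : ∀ i, Integrable fun x => dirDeriv (spaceVec i) (J i) (x, t) := fun i =>
    ((hJc i).dirDeriv _).integrable_slice (hDJ i _) t
  rw [integral_sub ((hc.dirDeriv _).integrable_slice (hD _) t)
    (integrable_finsetSum _ fun i _ => hint i), integral_finsetSum _ fun i _ => hint i]
  have h0 : ∀ i, ∫ x, dirDeriv (spaceVec i) (J i) (x, t) = 0 := fun i =>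
    integral_dirDeriv_space (hJ i) (hJc i) _ t
  simp only [h0, Finset.sum_const_zero, sub_zero]
  exact hasDerivAt_integral_slice hF hc t

end Slices

/-! ### Finite speed of propagation -/

/-! ### Calculus of directional derivatives -/

section DirDerivRules

variable {d : ℕ} {G : Type*} [NormedAddCommGroup G] [NormedSpace ℝ G] (v : Rd d × ℝ)
  {z : Rd d × ℝ}

lemma dirDeriv_add {f g : Rd d × ℝ → G} (hf : DifferentiableAt ℝ f z)
    (hg : DifferentiableAt ℝ g z) :
    dirDeriv v (fun z => f z + g z) z = dirDeriv v f z + dirDeriv v g z := by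
  simp [dirDeriv, fderiv_fun_add hf hg]

lemma dirDeriv_sub {f g : Rd d × ℝ → G} (hf : DifferentiableAt ℝ f z)
    (hg : DifferentiableAt ℝ g z) :
    dirDeriv v (fun z => f z - g z) z = dirDeriv v f z - dirDeriv v g z := by
  simp [dirDeriv, fderiv_fun_sub hf hg]

lemma dirDeriv_sum {ι : Type*} (s : Finset ι) {f : ι → Rd d × ℝ → G}
    (hf : ∀ i ∈ s, DifferentiableAt ℝ (f i) z) :
    dirDeriv v (fun z => ∑ i ∈ s, f i z) z = ∑ i ∈ s, dirDeriv v (f i) z := by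
  simp [dirDeriv, fderiv_fun_sum hf]

lemma dirDeriv_smul {f : Rd d × ℝ → ℝ} {g : Rd d × ℝ → G} (hf : DifferentiableAt ℝ f z)
    (hg : DifferentiableAt ℝ g z) :
    dirDeriv v (fun z => f z • g z) z = f z • dirDeriv v g z + dirDeriv v f z • g z := by
  simp [dirDeriv, fderiv_fun_smul hf hg]

lemma dirDeriv_mul {f g : Rd d × ℝ → ℝ} (hf : DifferentiableAt ℝ f z)
    (hg : DifferentiableAt ℝ g z) :
    dirDeriv v (fun z => f z * g z) z = f z * dirDeriv v g z + dirDeriv v f z * g z :=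
  dirDeriv_smul v hf hg

lemma dirDeriv_sq {f : Rd d × ℝ → ℝ} (hf : DifferentiableAt ℝ f z) :
    dirDeriv v (fun z => f z ^ 2) z = 2 * f z * dirDeriv v f z := by
  simp only [sq]
  rw [dirDeriv_mul v hf hf]
  ring

lemma dirDeriv_comm {f : Rd d × ℝ → G} (hf : ContDiff ℝ 2 f) (v w : Rd d × ℝ) :
    dirDeriv v (dirDeriv w f) z = dirDeriv w (dirDeriv v f) z := by
  have hd : DifferentiableAt ℝ (fderiv ℝ f) z :=
    (hf.fderiv_right (m := 1) (by norm_num)).differentiable one_ne_zero z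
  have h : ∀ a b : Rd d × ℝ, dirDeriv a (dirDeriv b f) z = fderiv ℝ (fderiv ℝ f) z a b := by
    intro a b
    have h : HasFDerivAt (dirDeriv b f) _ z := hd.hasFDerivAt.clm_apply (hasFDerivAt_const b z)
    rw [dirDeriv, h.fderiv]
    simp
  rw [h, h]
  exact (hf.contDiffAt.isSymmSndFDerivAt (by simp)) v w

end DirDerivRules

/-! ### Weighted energy estimate in a light cone -/

section Energy

variable {d : ℕ}

/-- The wave equation for a function on space-time. -/
def SolvesWave {G : Type*} [NormedAddCommGroup G] [NormedSpace ℝ G] (w : Rd d × ℝ → G) : Prop :=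
  ∀ z, dirDeriv timeVec (dirDeriv timeVec w) z =
    ∑ i, dirDeriv (spaceVec i) (dirDeriv (spaceVec i) w) z

/-- A smooth weight supported in a light cone with vertex `(x₀, c * ρ)`, for `c = ± 1`. -/
def coneWeight (x₀ : Rd d) (ρ c : ℝ) (z : Rd d × ℝ) : ℝ :=
  expNegInvGlue ((ρ - c * z.2) ^ 2 - ‖z.1 - x₀‖ ^ 2)

lemma contDiff_coneWeight (x₀ : Rd d) (ρ c : ℝ) : ContDiff ℝ ∞ (coneWeight x₀ ρ c) := by
  unfold coneWeight
  refine expNegInvGlue.contDiff.comp ?_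
  have := contDiff_norm_sq ℝ (E := Rd d) (n := ∞)
  exact ((contDiff_const.sub (contDiff_const.mul contDiff_snd)).pow 2).sub
    (this.comp (contDiff_fst.sub contDiff_const))

lemma dirDeriv_coneWeight (x₀ : Rd d) (ρ c : ℝ) (v z : Rd d × ℝ) :
    dirDeriv v (coneWeight x₀ ρ c) z =
      deriv expNegInvGlue ((ρ - c * z.2) ^ 2 - ‖z.1 - x₀‖ ^ 2) *
        (-(2 * c * (ρ - c * z.2) * v.2) - 2 * inner ℝ (z.1 - x₀) v.1) := by
  have h1 : HasFDerivAt (fun z : Rd d × ℝ => z.1 - x₀) (ContinuousLinearMap.fst ℝ (Rd d) ℝ) z :=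
    hasFDerivAt_fst.sub_const x₀
  have h2 : HasFDerivAt (fun z : Rd d × ℝ => ρ - c * z.2)
      (-(c • ContinuousLinearMap.snd ℝ (Rd d) ℝ)) z :=
    (hasFDerivAt_snd.const_mul c).const_sub ρ
  have h3 := (h2.pow 2).sub h1.norm_sq
  have h4 : HasDerivAt expNegInvGlue (deriv expNegInvGlue ((ρ - c * z.2) ^ 2 - ‖z.1 - x₀‖ ^ 2))
      ((ρ - c * z.2) ^ 2 - ‖z.1 - x₀‖ ^ 2) :=
    (expNegInvGlue.contDiff.differentiable (n := 1) one_ne_zero _).hasDerivAt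
  have h5 := h4.comp_hasFDerivAt z h3
  have h6 : HasFDerivAt (coneWeight x₀ ρ c) _ z := h5
  rw [dirDeriv, h6.fderiv]
  simp only [smul_apply, sub_apply, neg_apply, smul_eq_mul, nsmul_eq_mul,
    ContinuousLinearMap.comp_apply, ContinuousLinearMap.coe_fst', ContinuousLinearMap.coe_snd',
    innerSL_apply_apply]
  push_cast
  ring

lemma deriv_expNegInvGlue_nonneg (y : ℝ) : 0 ≤ deriv expNegInvGlue y :=
  expNegInvGlue.monotone.deriv_nonneg

lemma deriv_expNegInvGlue_of_neg {y : ℝ} (hy : y < 0) : deriv expNegInvGlue y = 0 := by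
  have : expNegInvGlue =ᶠ[𝓝 y] fun _ => 0 := by
    filter_upwards [Iio_mem_nhds hy] with u hu
    exact expNegInvGlue.zero_of_nonpos (le_of_lt hu)
  simp [this.deriv_eq]

lemma spatiallyCompact_coneWeight (x₀ : Rd d) (ρ c : ℝ) :
    SpatiallyCompact (coneWeight x₀ ρ c) := fun T => by
  -- The weight vanishes once `‖x - x₀‖ ≥ |ρ - c * t|`; the triangle inequality gives this radius.
  refine ⟨|ρ| + |c| * T + ‖x₀‖, fun x t ht hx => expNegInvGlue.zero_of_nonpos ?_⟩
  have h1 : |ρ - c * t| ≤ |ρ| + |c| * T := by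
    refine (abs_sub _ _).trans ?_
    rw [abs_mul]
    gcongr
  have h2 : ‖x‖ ≤ ‖x - x₀‖ + ‖x₀‖ := by simpa using norm_add_le (x - x₀) x₀
  have h3 : |ρ - c * t| ≤ ‖x - x₀‖ := by linarith
  have := sq_le_sq' (by linarith [norm_nonneg (x - x₀), abs_nonneg (ρ - c * t)]) h3
  rw [sq_abs] at this
  simpa using this

/-- The pointwise energy inequality behind finite propagation speed. -/
lemma two_mul_sum_le {ι : Type*} (s : Finset ι) (a r : ℝ) (b y : ι → ℝ) (hr : 0 < r)
    (hy : ∑ i ∈ s, y i ^ 2 ≤ r ^ 2) :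
    2 * a * ∑ i ∈ s, b i * y i ≤ r * (a ^ 2 + ∑ i ∈ s, b i ^ 2) := by
  -- Expanding this square and inserting `hy` gives `r` times the claim.
  have h0 : 0 ≤ ∑ i ∈ s, (r * b i - a * y i) ^ 2 := Finset.sum_nonneg fun _ _ => sq_nonneg _
  have h1 : ∑ i ∈ s, (r * b i - a * y i) ^ 2 =
      r ^ 2 * ∑ i ∈ s, b i ^ 2 - 2 * r * a * ∑ i ∈ s, b i * y i + a ^ 2 * ∑ i ∈ s, y i ^ 2 := by
    simp only [Finset.mul_sum, ← Finset.sum_sub_distrib, ← Finset.sum_add_distrib]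
    exact Finset.sum_congr rfl fun i _ => by ring
  have h2 := mul_le_mul_of_nonneg_left hy (sq_nonneg a)
  refine le_of_mul_le_mul_left ?_ hr
  nlinarith

variable {w : Rd d × ℝ → ℝ}

/-- The energy density of `w`. -/
def energyDensity (w : Rd d × ℝ → ℝ) (z : Rd d × ℝ) : ℝ :=
  dirDeriv timeVec w z ^ 2 + ∑ i, dirDeriv (spaceVec i) w z ^ 2

lemma contDiff_energyDensity (hw : ContDiff ℝ ∞ w) : ContDiff ℝ ∞ (energyDensity w) :=
  ((hw.dirDeriv (by simp) _).pow 2).add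
    (ContDiff.sum fun i _ => (hw.dirDeriv (by simp) _).pow 2)

/-- The energy density has flux `2 ∂_t w ∂_i w`, and the wave equation makes the balance exact.
After weighting by `η`, only terms with a derivative of `η` survive. -/
lemma hasDerivAt_energy (hw : ContDiff ℝ ∞ w) (hwave : SolvesWave w) {η : Rd d × ℝ → ℝ}
    (hη : ContDiff ℝ ∞ η) (hηc : SpatiallyCompact η) (t : ℝ) :
    HasDerivAt (fun s => ∫ x, energyDensity w (x, s) * η (x, s))
      (∫ x, (energyDensity w (x, t) * dirDeriv timeVec η (x, t) - 2 * dirDeriv timeVec w (x, t) *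
        ∑ i, dirDeriv (spaceVec i) w (x, t) * dirDeriv (spaceVec i) η (x, t))) t := by
  have hD : ∀ v, ContDiff ℝ ∞ (dirDeriv v w) := fun v => hw.dirDeriv (by simp) v
  have hd : ∀ v z, DifferentiableAt ℝ (dirDeriv v w) z := fun v z =>
    (hD v).differentiable (by simp) z
  have hηd : ∀ z, DifferentiableAt ℝ η z := hη.differentiable (by simp)
  have hJ : ∀ i, ContDiff ℝ ∞ fun z => (dirDeriv timeVec w z * dirDeriv (spaceVec i) w z) * η z :=
    fun i => ((hD _).mul (hD _)).mul hη
  have hJ2 : ∀ i, ContDiff ℝ ∞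
      fun z => 2 * ((dirDeriv timeVec w z * dirDeriv (spaceVec i) w z) * η z) :=
    fun i => contDiff_const.mul (hJ i)
  have key := hasDerivAt_integral_slice_flux (F := fun z => energyDensity w z * η z)
    (J := fun i z => 2 * ((dirDeriv timeVec w z * dirDeriv (spaceVec i) w z) * η z))
    (((contDiff_energyDensity hw).mul hη).of_le (by simp)) (hηc.mono fun z hz => by simp [hz])
    (fun i => (hJ2 i).of_le (by simp)) (fun i => hηc.mono fun z hz => by simp [hz]) t
  have hz : ∀ z, energyDensity w z * dirDeriv timeVec η z - 2 * dirDeriv timeVec w z *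
      ∑ i, dirDeriv (spaceVec i) w z * dirDeriv (spaceVec i) η z =
      dirDeriv timeVec (fun z => energyDensity w z * η z) z - ∑ i, dirDeriv (spaceVec i)
        (fun z => 2 * ((dirDeriv timeVec w z * dirDeriv (spaceVec i) w z) * η z)) z := by
    intro z
    have e1 : dirDeriv timeVec (energyDensity w) z =
        2 * dirDeriv timeVec w z * dirDeriv timeVec (dirDeriv timeVec w) z +
          ∑ i, 2 * dirDeriv (spaceVec i) w z * dirDeriv timeVec (dirDeriv (spaceVec i) w) z := by
      unfold energyDensity
      rw [dirDeriv_add _ ((hd _ _).fun_pow 2)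
        (DifferentiableAt.fun_sum fun i _ => (hd (spaceVec i) z).fun_pow 2),
        dirDeriv_sq _ (hd _ _), dirDeriv_sum _ _ fun i _ => (hd (spaceVec i) z).fun_pow 2]
      simp only [dirDeriv_sq _ (hd _ _)]
    have e2 : ∀ i, dirDeriv (spaceVec i)
        (fun z => 2 * ((dirDeriv timeVec w z * dirDeriv (spaceVec i) w z) * η z)) z =
        2 * dirDeriv timeVec w z * (dirDeriv (spaceVec i) w z * dirDeriv (spaceVec i) η z) +
        (2 * dirDeriv timeVec w z * dirDeriv (spaceVec i) (dirDeriv (spaceVec i) w) z +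
          2 * dirDeriv (spaceVec i) w z * dirDeriv timeVec (dirDeriv (spaceVec i) w) z) * η z := by
      intro i
      rw [dirDeriv_mul _ (by fun_prop) ((hJ i).differentiable (by simp) z),
        dirDeriv_mul _ ((hd _ _).fun_mul (hd _ _)) (hηd z), dirDeriv_mul _ (hd _ _) (hd _ _),
        dirDeriv_comm (by exact_mod_cast contDiff_infty.1 hw 2) (spaceVec i) timeVec]
      have : dirDeriv (spaceVec i) (fun _ : Rd d × ℝ => (2 : ℝ)) z = 0 := by simp [dirDeriv]
      rw [this]
      ring
    have e3 := dirDeriv_mul timeVec ((contDiff_energyDensity hw).differentiable (by simp) z)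
      (hηd z)
    rw [e3, e1]
    simp only [e2]
    rw [hwave z, Finset.sum_add_distrib, ← Finset.mul_sum, ← Finset.sum_mul,
      Finset.sum_add_distrib, ← Finset.mul_sum]
    ring
  simp only [hz]
  exact key

/-- If the Cauchy data vanish on the base of a light cone, so does the time derivative at its
axis. -/
lemma timeDeriv_eq_zero (hw : ContDiff ℝ ∞ w) (hwave : SolvesWave w) (hw0 : ∀ x, w (x, 0) = 0)
    {x₀ : Rd d} {ρ c : ℝ} (hc : c ^ 2 = 1)
    (hw1 : ∀ x, ‖x - x₀‖ < ρ → dirDeriv timeVec w (x, 0) = 0) {t : ℝ} (ht : 0 ≤ c * t)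
    (htρ : c * t < ρ) : dirDeriv timeVec w (x₀, t) = 0 := by
  set η := coneWeight x₀ ρ c with hη
  have hηs : ContDiff ℝ ∞ η := contDiff_coneWeight x₀ ρ c
  have hηc : SpatiallyCompact η := spatiallyCompact_coneWeight x₀ ρ c
  have hη0 : ∀ z, 0 ≤ η z := fun z => expNegInvGlue.nonneg _
  have he0 : ∀ z, 0 ≤ energyDensity w z := fun z =>
    add_nonneg (sq_nonneg _) (Finset.sum_nonneg fun _ _ => sq_nonneg _)
  set E : ℝ → ℝ := fun s => ∫ x, energyDensity w (x, s) * η (x, s) with hE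
  -- The parameter `τ = c * s` grows from `0` to the vertex, so one monotonicity argument covers
  -- both directions of time.
  have hcE : ∀ τ, HasDerivAt (fun τ => E (c * τ)) (_ * c) τ := fun τ =>
    (hasDerivAt_energy hw hwave hηs hηc (c * τ)).comp_of_eq τ
      (by simpa using (hasDerivAt_id τ).const_mul c) rfl
  have hanti : AntitoneOn (fun τ => E (c * τ)) (Icc 0 (c * t)) := by
    refine antitoneOn_of_deriv_nonpos (convex_Icc _ _)
      (fun τ _ => (hcE τ).continuousAt.continuousWithinAt)
      (fun τ _ => (hcE τ).differentiableAt.differentiableWithinAt) fun τ hτ => ?_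
    rw [interior_Icc] at hτ
    rw [(hcE τ).deriv, ← integral_mul_const]
    refine integral_nonpos fun x => ?_
    have hr : 0 < ρ - τ := by linarith [hτ.2]
    have hcc : ρ - c * (c * τ) = ρ - τ := by linear_combination -τ * hc
    have h1 := dirDeriv_coneWeight x₀ ρ c timeVec (x, c * τ)
    have h2 := fun i => dirDeriv_coneWeight x₀ ρ c (spaceVec i) (x, c * τ)
    simp only [timeVec, spaceVec, hcc, inner_zero_right, mul_zero, sub_zero, mul_one, neg_zero,
      zero_sub, EuclideanSpace.inner_single_right, conj_trivial, one_mul, ← hη] at h1 h2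
    simp only [Pi.zero_apply]
    rw [timeVec, h1]
    simp only [spaceVec, h2]
    set g' := deriv expNegInvGlue ((ρ - τ) ^ 2 - ‖x - x₀‖ ^ 2) with hg'
    -- Outside the cone the weight is locally constant. Inside, `‖x - x₀‖ ≤ ρ - τ`, so the flux term
    -- is dominated by the decrease of the weight.
    by_cases hq : (ρ - τ) ^ 2 - ‖x - x₀‖ ^ 2 < 0
    · have : g' = 0 := deriv_expNegInvGlue_of_neg hq
      simp [this]
    · have hg0 : 0 ≤ g' := deriv_expNegInvGlue_nonneg _
      have hy : ∑ i, (x - x₀) i ^ 2 ≤ (ρ - τ) ^ 2 := by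
        rw [EuclideanSpace.real_norm_sq_eq] at hq
        linarith
      have key := two_mul_sum_le Finset.univ (c * dirDeriv (0, 1) w (x, c * τ)) (ρ - τ)
        (fun i => dirDeriv (EuclideanSpace.single i 1, 0) w (x, c * τ)) _ hr hy
      have hs : ∑ i, dirDeriv (EuclideanSpace.single i 1, 0) w (x, c * τ) *
          (g' * -(2 * (x - x₀) i)) = -2 * g' *
          ∑ i, dirDeriv (EuclideanSpace.single i 1, 0) w (x, c * τ) * (x - x₀) i := by
        rw [Finset.mul_sum]
        exact Finset.sum_congr rfl fun i _ => by ring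
      rw [hs]
      rw [mul_pow, hc, one_mul] at key
      have := mul_le_mul_of_nonneg_left key hg0
      simp only [energyDensity, timeVec, spaceVec]
      linear_combination 2 * this - 2 * g' * (ρ - τ) * (dirDeriv (0, 1) w (x, c * τ) ^ 2 +
        ∑ i, dirDeriv (EuclideanSpace.single i 1, 0) w (x, c * τ) ^ 2) * hc
  have hE0 : E 0 = 0 := by
    refine integral_eq_zero_of_ae (Eventually.of_forall fun x => ?_)
    -- Spatial derivatives are tangential to the initial slice, where `w` vanishes identically.
    have hsp : ∀ i, dirDeriv (spaceVec i) w (x, 0) = 0 := fun i => by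
      rw [spaceVec, ← fderiv_slice (hw.differentiable (by simp))]
      simp [hw0]
    by_cases hx : ‖x - x₀‖ < ρ
    · simp [energyDensity, hw1 x hx, hsp]
    · have : η (x, 0) = 0 := by
        refine expNegInvGlue.zero_of_nonpos ?_
        have : ρ ^ 2 ≤ ‖x - x₀‖ ^ 2 := pow_le_pow_left₀ (by linarith) (not_lt.1 hx) 2
        simpa using this
      simp [this]
  have hEt : E t ≤ 0 := by
    have := hanti (left_mem_Icc.2 ht) (right_mem_Icc.2 ht) ht
    simp only [mul_zero, hE0] at this
    rwa [← mul_assoc, ← sq, hc, one_mul] at this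
  -- A nonzero value would make the continuous nonnegative integrand positive at `x₀`, contradicting
  -- `hEt`.
  by_contra hne
  have hηpos : 0 < η (x₀, t) := by
    refine expNegInvGlue.pos_of_pos ?_
    simp only [sub_self, norm_zero]
    have : 0 < ρ - c * t := by linarith
    nlinarith
  have hcont : Continuous fun x => energyDensity w (x, t) * η (x, t) :=
    ((contDiff_energyDensity hw).continuous.mul hηs.continuous).comp (by fun_prop)
  have hsupp : SpatiallyCompact fun z => energyDensity w z * η z :=
    hηc.mono fun z hz => by simp [hz]
  have := hcont.integral_pos_of_hasCompactSupport_nonneg_nonzero (μ := volume) (x := x₀)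
    (hsupp.hasCompactSupport_slice t) (fun x => mul_nonneg (he0 _) (hη0 _))
    (mul_pos (add_pos_of_pos_of_nonneg (by positivity)
      (Finset.sum_nonneg fun _ _ => sq_nonneg _)) hηpos).ne'
  exact absurd hEt (not_le.2 this)

/-- **Finite speed of propagation.** -/
lemma eq_zero_of_lt_norm (hw : ContDiff ℝ ∞ w) (hwave : SolvesWave w) (hw0 : ∀ x, w (x, 0) = 0)
    {R : ℝ} (hw1 : ∀ x, R < ‖x‖ → dirDeriv timeVec w (x, 0) = 0) {x : Rd d} {t : ℝ}
    (hx : R + |t| < ‖x‖) : w (x, t) = 0 := by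
  -- The ball of radius `‖x‖ - R` about `x` avoids the support of the data, and `|t| < ‖x‖ - R`
  -- keeps time `s` below the vertex of its cone.
  have hz : ∀ s, |s| ≤ |t| → dirDeriv timeVec w (x, s) = 0 := by
    intro s hs
    have hb : ∀ y, ‖y - x‖ < ‖x‖ - R → dirDeriv timeVec w (y, 0) = 0 := fun y hy => by
      refine hw1 y ?_
      have := norm_sub_norm_le x y
      rw [norm_sub_rev] at this
      linarith
    rcases le_total 0 s with h | h
    · exact timeDeriv_eq_zero hw hwave hw0 (c := 1) (by norm_num) hb (by linarith)
        (by rw [abs_of_nonneg h] at hs; linarith)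
    · exact timeDeriv_eq_zero hw hwave hw0 (c := -1) (by norm_num) hb (by linarith)
        (by rw [abs_of_nonpos h] at hs; linarith)
  have hmv := (convex_uIcc (0 : ℝ) t).norm_image_sub_le_of_norm_hasDerivWithin_le (C := 0)
    (f := fun s => w (x, s)) (f' := fun s => dirDeriv timeVec w (x, s))
    (fun s _ => (hasDerivAt_time (hw.differentiable (by simp)) x s).hasDerivWithinAt)
    (fun s hs => by
      rw [hz s (by simpa using abs_sub_left_of_mem_uIcc hs), norm_zero])
    left_mem_uIcc right_mem_uIcc
  simpa [hw0] using hmv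

end Energy

/-! ### Solutions of the wave equation by the Fourier transform -/

section Existence

open scoped FourierTransform Real

variable {d : ℕ}

/-- Minus the duality pairing of frequencies and points in space-time. -/
def phaseForm (d : ℕ) : Rd d × ℝ →L[ℝ] Rd d × ℝ →L[ℝ] ℝ :=
  let B : Rd d →L[ℝ] Rd d →L[ℝ] ℝ := innerSL ℝ;
  -(B.bilinearComp (ContinuousLinearMap.fst ℝ (Rd d) ℝ) (ContinuousLinearMap.fst ℝ (Rd d) ℝ) +
    (ContinuousLinearMap.mul ℝ ℝ).bilinearComp (ContinuousLinearMap.snd ℝ (Rd d) ℝ)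
      (ContinuousLinearMap.snd ℝ (Rd d) ℝ))

lemma phaseForm_apply (v z : Rd d × ℝ) :
    phaseForm d v z = -(inner ℝ v.1 z.1 + v.2 * z.2) := rfl

/-- The measure on the solid light cone `|τ| ≤ |ξ|` in frequency space which is the image of
`dξ dσ` under `τ = σ |ξ|`. -/
def coneMeasure (d : ℕ) : Measure (Rd d × ℝ) :=
  Measure.map (fun p : Rd d × ℝ => (p.1, p.2 * ‖p.1‖))
    ((volume : Measure (Rd d)).prod ((volume : Measure ℝ).restrict (Icc (-1) 1)))

/-- All moments of `h` with respect to `coneMeasure` are finite. -/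
def HasMoments (h : Rd d × ℝ → ℂ) : Prop :=
  AEStronglyMeasurable h (coneMeasure d) ∧
    ∀ n : ℕ, Integrable (fun v => ‖v‖ ^ n * ‖h v‖) (coneMeasure d)

/-- The Fourier transform on the solid light cone. -/
def coneFourier (h : Rd d × ℝ → ℂ) : Rd d × ℝ → ℂ :=
  VectorFourier.fourierIntegral 𝐞 (coneMeasure d) (phaseForm d).toLinearMap₁₂ h

/-- The symbol of the derivative in direction `w`. -/
def symbol (w v : Rd d × ℝ) : ℂ := 2 * π * Complex.I * ((inner ℝ v.1 w.1 + v.2 * w.2 : ℝ) : ℂ)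

/-- The symbol grows linearly, so it costs one moment; having all moments makes the class stable
under every derivative. -/
lemma HasMoments.symbol_mul {h : Rd d × ℝ → ℂ} (hh : HasMoments h) (w : Rd d × ℝ) :
    HasMoments fun v => symbol w v * h v := by
  have hs : Continuous (symbol w) := by
    unfold symbol
    fun_prop
  refine ⟨hs.aestronglyMeasurable.mul hh.1, fun n => ?_⟩
  refine ((hh.2 (n + 1)).const_mul (2 * π * (‖phaseForm d‖ * ‖w‖))).mono' ?_
    (Eventually.of_forall fun v => ?_)
  · exact ((continuous_norm.pow n).aestronglyMeasurable).mul
      (hs.aestronglyMeasurable.mul hh.1).norm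
  · have h1 : ‖symbol w v‖ ≤ 2 * π * (‖phaseForm d‖ * ‖v‖ * ‖w‖) := by
      have := (phaseForm d).le_opNorm₂ v w
      rw [phaseForm_apply, norm_neg] at this
      rw [symbol, norm_mul, norm_mul, norm_mul, Complex.norm_I, Complex.norm_real,
        Complex.norm_real, Complex.norm_two, Real.norm_of_nonneg Real.pi_pos.le, mul_one]
      gcongr
    rw [norm_mul, norm_pow, norm_norm, norm_norm, norm_mul]
    calc ‖v‖ ^ n * (‖symbol w v‖ * ‖h v‖)
        ≤ ‖v‖ ^ n * (2 * π * (‖phaseForm d‖ * ‖v‖ * ‖w‖) * ‖h v‖) := by gcongr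
      _ = _ := by ring

lemma HasMoments.integrable {h : Rd d × ℝ → ℂ} (hh : HasMoments h) :
    Integrable h (coneMeasure d) :=
  (integrable_norm_iff hh.1).1 (by simpa using hh.2 0)

lemma HasMoments.contDiff {h : Rd d × ℝ → ℂ} (hh : HasMoments h) :
    ContDiff ℝ ∞ (coneFourier h) :=
  VectorFourier.contDiff_fourierIntegral (phaseForm d) fun n _ => hh.2 n

lemma HasMoments.dirDeriv {h : Rd d × ℝ → ℂ} (hh : HasMoments h) (w : Rd d × ℝ) :
    dirDeriv w (coneFourier h) = coneFourier fun v => symbol w v * h v := by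
  funext z
  have h1 : Integrable (fun v => ‖v‖ * ‖h v‖) (coneMeasure d) := by simpa using hh.2 1
  have hF := (VectorFourier.hasFDerivAt_fourierIntegral (phaseForm d) hh.integrable h1 z).fderiv
  have hint : Integrable (VectorFourier.fourierSMulRight (phaseForm d) h) (coneMeasure d) := by
    refine (h1.const_mul (2 * π * ‖phaseForm d‖)).mono' hh.1.fourierSMulRight
      (Eventually.of_forall fun v => ?_)
    exact (VectorFourier.norm_fourierSMulRight_le _ _ _).trans (by rw [mul_assoc])
  rw [CEP.dirDeriv, coneFourier, hF, coneFourier, VectorFourier.fourierIntegral,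
    ContinuousLinearMap.integral_apply]
  · refine integral_congr_ae (Eventually.of_forall fun v => ?_)
    simp only [VectorFourier.fourierSMulRight_apply, Circle.smul_def, smul_apply,
      phaseForm_apply, symbol, Complex.real_smul, smul_eq_mul]
    push_cast
    ring
  · exact (VectorFourier.fourierIntegral_convergent_iff Real.continuous_fourierChar
      (by exact (phaseForm d).continuous₂) z).2 hint

lemma continuous_coneParam : Continuous fun p : Rd d × ℝ => (p.1, p.2 * ‖p.1‖) := by fun_prop

/-- On the solid cone `|τ| ≤ |ξ|`, so the norm of `(ξ, τ)` is `|ξ|` and the moments reduce to those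
of `φ`. -/
lemma hasMoments_of_schwartz (φ : SchwartzMap (Rd d) ℂ) :
    HasMoments fun v : Rd d × ℝ => φ v.1 := by
  have hc : Continuous fun v : Rd d × ℝ => φ v.1 := φ.continuous.comp continuous_fst
  refine ⟨hc.aestronglyMeasurable, fun n => ?_⟩
  have hc' : Continuous fun v : Rd d × ℝ => ‖v‖ ^ n * ‖φ v.1‖ := by fun_prop
  rw [coneMeasure, integrable_map_measure hc'.aestronglyMeasurable
    continuous_coneParam.measurable.aemeasurable]
  have hi : Integrable (fun p : Rd d × ℝ => ‖p.1‖ ^ n * ‖φ p.1‖)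
      ((volume : Measure (Rd d)).prod ((volume : Measure ℝ).restrict (Icc (-1) 1))) :=
    (φ.integrable_pow_mul volume n).comp_fst _
  refine hi.mono' (hc'.comp continuous_coneParam).aestronglyMeasurable ?_
  have hae : ∀ᵐ p : Rd d × ℝ ∂((volume : Measure (Rd d)).prod
      ((volume : Measure ℝ).restrict (Icc (-1) 1))), p.2 ∈ Icc (-1 : ℝ) 1 :=
    Measure.quasiMeasurePreserving_snd.ae (ae_restrict_mem measurableSet_Icc)
  filter_upwards [hae] with p hp
  have h2 : |p.2| ≤ 1 := abs_le.2 hp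
  have h1 : ‖(p.1, p.2 * ‖p.1‖)‖ = ‖p.1‖ := by
    rw [Prod.norm_mk, max_eq_left]
    rw [norm_mul, norm_norm, Real.norm_eq_abs]
    exact mul_le_of_le_one_left (norm_nonneg _) h2
  simp only [Function.comp_apply, h1]
  rw [Real.norm_of_nonneg (by positivity)]

lemma integrable_phase_smul {h : Rd d × ℝ → ℂ} (hh : Integrable h (coneMeasure d))
    (z : Rd d × ℝ) :
    Integrable (fun v => 𝐞 (-(phaseForm d).toLinearMap₁₂ v z) • h v) (coneMeasure d) :=
  (VectorFourier.fourierIntegral_convergent_iff Real.continuous_fourierChar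
    (by exact (phaseForm d).continuous₂) z).2 hh

lemma coneFourier_eq {h : Rd d × ℝ → ℂ} (hh : Integrable h (coneMeasure d)) (z : Rd d × ℝ) :
    coneFourier h z = ∫ ξ, ∫ σ in Icc (-1 : ℝ) 1,
      Complex.exp (2 * π * (inner ℝ ξ z.1 : ℝ) * Complex.I) *
        Complex.exp (2 * π * (σ * ‖ξ‖ * z.2 : ℝ) * Complex.I) * h (ξ, σ * ‖ξ‖) := by
  have e : ∀ v : Rd d × ℝ, 𝐞 (-(phaseForm d).toLinearMap₁₂ v z) • h v =
      Complex.exp (2 * π * (inner ℝ v.1 z.1 : ℝ) * Complex.I) *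
        Complex.exp (2 * π * (v.2 * z.2 : ℝ) * Complex.I) * h v := fun v => by
    -- The sign of `phaseForm` cancels the one in the Fourier kernel, which gives the inverse
    -- transform.
    have e' : (phaseForm d).toLinearMap₁₂ v z = -(inner ℝ v.1 z.1 + v.2 * z.2) := rfl
    rw [e', Circle.smul_def, Real.fourierChar_apply, ← Complex.exp_add, smul_eq_mul]
    congr 2
    push_cast
    ring
  have hi := integrable_phase_smul hh z
  have hI := hi
  simp only [e] at hI
  rw [coneMeasure, integrable_map_measure hI.1
    continuous_coneParam.measurable.aemeasurable] at hI
  refine Eq.trans ?_ (integral_prod _ hI)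
  have : coneFourier h z = ∫ v, 𝐞 (-(phaseForm d).toLinearMap₁₂ v z) • h v ∂(coneMeasure d) := rfl
  rw [this, coneMeasure, integral_map continuous_coneParam.measurable.aemeasurable hi.1]
  simp only [e, Function.comp_def]

/-- The Euler–Poisson–Darboux identity on the Fourier side. -/
lemma integral_symbol_eq_zero (a t : ℝ) :
    ∫ σ in Icc (-1 : ℝ) 1, Complex.exp (2 * π * (σ * a * t : ℝ) * Complex.I) *
      (2 * π * Complex.I * σ * a + 2 * π ^ 2 * t * a ^ 2 * (1 - σ ^ 2)) = 0 := by
  rw [integral_Icc_eq_integral_Ioc, ← intervalIntegral.integral_of_le (by norm_num)]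
  -- The integrand has an explicit primitive, and its factor `1 - σ²` vanishes at both endpoints.
  have hd : ∀ σ : ℝ, HasDerivAt (fun σ : ℝ => -π * Complex.I * a * (1 - (σ : ℂ) ^ 2) *
      Complex.exp (2 * π * (σ * a * t : ℝ) * Complex.I))
      (Complex.exp (2 * π * (σ * a * t : ℝ) * Complex.I) *
      (2 * π * Complex.I * σ * a + 2 * π ^ 2 * t * a ^ 2 * (1 - σ ^ 2))) σ := fun σ => by
    have hσ : HasDerivAt (fun σ : ℝ => (σ : ℂ)) 1 σ := Complex.ofRealCLM.hasDerivAt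
    have h1 : HasDerivAt (fun σ : ℝ => -π * Complex.I * a * (1 - (σ : ℂ) ^ 2))
        (-π * Complex.I * a * -(2 * σ)) σ := by
      simpa using ((hσ.pow 2).const_sub 1).const_mul (-π * Complex.I * a)
    have h2 : HasDerivAt (fun σ : ℝ => 2 * (π : ℂ) * ((σ * a * t : ℝ) : ℂ) * Complex.I)
        (2 * π * a * t * Complex.I) σ := by
      have := hσ.const_mul (2 * π * a * t * Complex.I)
      rw [mul_one] at this
      refine this.congr_of_eventuallyEq (Eventually.of_forall fun s => ?_)
      push_cast
      ring
    convert! h1.mul h2.cexp using 1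
    linear_combination (2 * π ^ 2 * t * a ^ 2 * (1 - (σ : ℂ) ^ 2) *
      Complex.exp (2 * π * (σ * a * t : ℝ) * Complex.I)) * Complex.I_sq
  rw [intervalIntegral.integral_eq_sub_of_hasDerivAt (fun σ _ => hd σ)
    (Continuous.intervalIntegrable (by fun_prop) _ _)]
  simp

lemma symbol_timeVec (v : Rd d × ℝ) : symbol timeVec v = 2 * π * Complex.I * v.2 := by
  simp [symbol, timeVec]

lemma sum_symbol_spaceVec_sq (v : Rd d × ℝ) :
    ∑ i, symbol (spaceVec i) v * symbol (spaceVec i) v = -(4 * π ^ 2 * (‖v.1‖ : ℂ) ^ 2) := by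
  have h : ∀ i, symbol (spaceVec i) v * symbol (spaceVec i) v =
      -(4 * π ^ 2) * ((v.1 i ^ 2 : ℝ) : ℂ) := fun i => by
    simp only [symbol, spaceVec, EuclideanSpace.inner_single_right, conj_trivial, one_mul,
      mul_zero, add_zero]
    push_cast
    linear_combination (4 * (π : ℂ) ^ 2 * (v.1 i : ℂ) ^ 2) * Complex.I_sq
  simp only [h]
  rw [← Finset.mul_sum, ← Complex.ofReal_sum, ← EuclideanSpace.real_norm_sq_eq]
  push_cast
  ring

/-- For `G = coneFourier φ` this says `□(t G / 2) = 0`, since `∂_t²(t G / 2) = ∂_t G + (t/2) ∂_t²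
G`. At frequency `(ξ, σ|ξ|)` the symbol of `□` is `4π²|ξ|²(1 - σ²)`, so the `σ`-integral is that of
`integral_symbol_eq_zero`. -/
lemma coneFourier_darboux (φ : SchwartzMap (Rd d) ℂ) (z : Rd d × ℝ) :
    dirDeriv timeVec (coneFourier fun v => φ v.1) z + ((z.2 / 2 : ℝ) : ℂ) *
      (dirDeriv timeVec (dirDeriv timeVec (coneFourier fun v => φ v.1)) z -
        ∑ i, dirDeriv (spaceVec i) (dirDeriv (spaceVec i) (coneFourier fun v => φ v.1)) z) = 0 := by
  have hφ := hasMoments_of_schwartz φ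
  have ht := hφ.symbol_mul timeVec
  have htt := ht.symbol_mul timeVec
  have hii := fun i : Fin d => (hφ.symbol_mul (spaceVec i)).symbol_mul (spaceVec i)
  -- The coefficient is frozen at `z`, so the whole expression becomes a single cone integral
  -- evaluated at `z`.
  set H : Rd d × ℝ → ℂ := fun v => symbol timeVec v * φ v.1 + ((z.2 / 2 : ℝ) : ℂ) *
    (symbol timeVec v * (symbol timeVec v * φ v.1) -
      ∑ i, symbol (spaceVec i) v * (symbol (spaceVec i) v * φ v.1)) with hHdef
  have hsum := integrable_finsetSum Finset.univ fun i _ => (hii i).integrable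
  have hH : Integrable H (coneMeasure d) :=
    ht.integrable.add ((htt.integrable.sub hsum).const_mul _)
  have hlin : coneFourier H z = coneFourier (fun v => symbol timeVec v * φ v.1) z +
      ((z.2 / 2 : ℝ) : ℂ) *
        (coneFourier (fun v => symbol timeVec v * (symbol timeVec v * φ v.1)) z -
        ∑ i, coneFourier (fun v => symbol (spaceVec i) v * (symbol (spaceVec i) v * φ v.1)) z) := by
    have hi1 := integrable_phase_smul ht.integrable z
    have hi2 := integrable_phase_smul htt.integrable z
    have hi3 := fun i => integrable_phase_smul (hii i).integrable z
    simp only [coneFourier, VectorFourier.fourierIntegral]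
    rw [← integral_finsetSum _ fun i _ => hi3 i,
      ← integral_sub hi2 (integrable_finsetSum _ fun i _ => hi3 i), ← integral_const_mul,
      ← integral_add hi1 (by
        simpa only [Pi.sub_apply] using
          (hi2.sub (integrable_finsetSum Finset.univ fun i _ => hi3 i)).const_mul _)]
    refine integral_congr_ae (Eventually.of_forall fun v => ?_)
    simp only [hHdef, Circle.smul_def, smul_eq_mul, ← Finset.mul_sum]
    ring
  rw [hφ.dirDeriv, ht.dirDeriv]
  simp only [hφ.dirDeriv, (hφ.symbol_mul _).dirDeriv]
  rw [← hlin, coneFourier_eq hH]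
  refine integral_eq_zero_of_ae (Eventually.of_forall fun ξ => ?_)
  have hval : ∀ σ : ℝ, H (ξ, σ * ‖ξ‖) = (2 * π * Complex.I * σ * ‖ξ‖ +
      2 * π ^ 2 * z.2 * ‖ξ‖ ^ 2 * (1 - (σ : ℂ) ^ 2)) * φ ξ := fun σ => by
    simp only [hHdef, ← mul_assoc, ← Finset.sum_mul]
    rw [sum_symbol_spaceVec_sq, symbol_timeVec]
    push_cast
    linear_combination (2 * (π : ℂ) ^ 2 * z.2 * ‖ξ‖ ^ 2 * (σ : ℂ) ^ 2 * φ ξ) * Complex.I_sq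
  calc _ = ∫ σ in Icc (-1 : ℝ) 1, (Complex.exp (2 * π * (inner ℝ ξ z.1 : ℝ) * Complex.I) * φ ξ) *
        (Complex.exp (2 * π * (σ * ‖ξ‖ * z.2 : ℝ) * Complex.I) *
          (2 * π * Complex.I * σ * ‖ξ‖ + 2 * π ^ 2 * z.2 * ‖ξ‖ ^ 2 * (1 - (σ : ℂ) ^ 2))) := by
        refine integral_congr_ae (Eventually.of_forall fun σ => ?_)
        simp only [hval]
        ring
    _ = 0 := by
        rw [integral_const_mul, integral_symbol_eq_zero, mul_zero]

/-- At time `0` the phase does not depend on `σ`. The factor `2` is the length of `[-1, 1]`, and the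
rest is Fourier inversion. -/
lemma coneFourier_zero_time (φ : SchwartzMap (Rd d) ℂ) (x : Rd d) :
    coneFourier (fun v => (𝓕 φ) v.1) (x, 0) = 2 * φ x := by
  rw [coneFourier_eq (hasMoments_of_schwartz (𝓕 φ)).integrable]
  have h : ∀ ξ : Rd d, ∫ σ in Icc (-1 : ℝ) 1,
      Complex.exp (2 * π * (inner ℝ ξ x : ℝ) * Complex.I) *
        Complex.exp (2 * π * (σ * ‖ξ‖ * 0 : ℝ) * Complex.I) * (𝓕 φ) ξ =
      2 * (Complex.exp (((2 * π * inner ℝ ξ x : ℝ) : ℂ) * Complex.I) • (𝓕 φ) ξ) := fun ξ => by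
    simp
    norm_num
  simp only [h]
  rw [integral_const_mul, ← Real.fourierInv_eq', SchwartzMap.fourier_coe,
    φ.continuous.fourierInv_fourier_eq φ.integrable (by
      rw [← SchwartzMap.fourier_coe]
      exact (𝓕 φ).integrable)]

lemma dirDeriv_re {F : Rd d × ℝ → ℂ} (hF : Differentiable ℝ F) (v : Rd d × ℝ) :
    dirDeriv v (fun z => (F z).re) = fun z => (dirDeriv v F z).re := by
  funext z
  have h : HasFDerivAt (fun z => (F z).re) _ z :=
    Complex.reCLM.hasFDerivAt.comp z (hF z).hasFDerivAt
  rw [dirDeriv, h.fderiv]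
  rfl

lemma dirDeriv_translate {G : Type*} [NormedAddCommGroup G] [NormedSpace ℝ G]
    (F : Rd d × ℝ → G) (v a : Rd d × ℝ) :
    dirDeriv v (fun z => F (z + a)) = fun z => dirDeriv v F (z + a) := by
  funext z
  rw [dirDeriv, fderiv_comp_add_right]
  rfl

/-- The Cauchy problem for the wave equation with vanishing initial value and smooth, compactly
supported initial velocity. -/
theorem exists_solvesWave {ψ : Rd d → ℝ} (hψ : ContDiff ℝ ∞ ψ) (hψc : HasCompactSupport ψ)
    (t₀ : ℝ) : ∃ W : Rd d × ℝ → ℝ, ContDiff ℝ ∞ W ∧ SolvesWave W ∧ SpatiallyCompact W ∧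
      (∀ x, W (x, t₀) = 0) ∧ ∀ x, dirDeriv timeVec W (x, t₀) = ψ x := by
  have hψ' : ContDiff ℝ ∞ fun x => (ψ x : ℂ) := Complex.ofRealCLM.contDiff.comp hψ
  have hψc' : HasCompactSupport fun x => (ψ x : ℂ) := hψc.comp_left (g := Complex.ofReal) (by simp)
  set φ : SchwartzMap (Rd d) ℂ := hψc'.toSchwartzMap hψ' with hφ
  set G := coneFourier fun v : Rd d × ℝ => (𝓕 φ) v.1 with hG
  have hGs : ContDiff ℝ ∞ G := (hasMoments_of_schwartz (𝓕 φ)).contDiff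
  have hD : ∀ v, ContDiff ℝ ∞ (dirDeriv v G) := fun v => hGs.dirDeriv (by simp) v
  -- The product `c • G` vanishes at time `0` and has velocity `G / 2` there; the half cancels the
  -- factor `2` in `coneFourier_zero_time`.
  set c : Rd d × ℝ → ℝ := fun z => z.2 / 2 with hc
  have hcs : ContDiff ℝ ∞ c := contDiff_snd.div_const 2
  have hcd : ∀ z v, dirDeriv v c z = v.2 / 2 := fun z v => by
    have h : HasFDerivAt c ((2 : ℝ)⁻¹ • ContinuousLinearMap.snd ℝ (Rd d) ℝ) z := by
      have := (hasFDerivAt_snd (𝕜 := ℝ) (E := Rd d) (F := ℝ) (p := z)).const_mul (2 : ℝ)⁻¹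
      refine this.congr_of_eventuallyEq (Eventually.of_forall fun y => ?_)
      simp [hc, div_eq_inv_mul]
    rw [dirDeriv, h.fderiv]
    simp [div_eq_inv_mul]
  set w' : Rd d × ℝ → ℂ := fun z => c z • G z with hw'
  have hws' : ContDiff ℝ ∞ w' := hcs.smul hGs
  have hdc : Differentiable ℝ c := hcs.differentiable (by simp)
  have hdG : Differentiable ℝ G := hGs.differentiable (by simp)
  have hdD : ∀ v, Differentiable ℝ (dirDeriv v G) := fun v => (hD v).differentiable (by simp)
  have h1 : ∀ v, dirDeriv v w' = fun z => c z • dirDeriv v G z + (v.2 / 2) • G z := fun v => by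
    funext z
    rw [hw', dirDeriv_smul v (hdc z) (hdG z), hcd]
  have h2 : ∀ v z, dirDeriv v (dirDeriv v w') z =
      v.2 • dirDeriv v G z + c z • dirDeriv v (dirDeriv v G) z := fun v z => by
    have hconst : dirDeriv v (fun z => (v.2 / 2) • G z) z = (v.2 / 2) • dirDeriv v G z := by
      rw [dirDeriv_smul v (differentiableAt_const _) (hdG z)]
      simp [dirDeriv]
    rw [h1, dirDeriv_add v ((hdc z).fun_smul (hdD v z)) ((hdG z).fun_const_smul _), hconst,
      dirDeriv_smul v (hdc z) (hdD v z), hcd]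
    module
  have hwave' : SolvesWave w' := fun z => by
    have key := coneFourier_darboux (𝓕 φ) z
    rw [← hG] at key
    simp only [h2]
    simp only [timeVec, spaceVec, one_smul, zero_smul, zero_add] at key ⊢
    rw [← Finset.smul_sum, Complex.real_smul, Complex.real_smul]
    linear_combination key
  set w : Rd d × ℝ → ℝ := fun z => (w' z).re with hw
  have hws : ContDiff ℝ ∞ w := Complex.reCLM.contDiff.comp hws'
  have hdw' := hws'.differentiable (by simp)
  have hDw : ∀ v, dirDeriv v w = fun z => (dirDeriv v w' z).re := fun v => dirDeriv_re hdw' v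
  have hwave : SolvesWave w := fun z => by
    have hDD : ∀ v, dirDeriv v (dirDeriv v w) z = (dirDeriv v (dirDeriv v w') z).re := fun v => by
      rw [hDw, dirDeriv_re ((hws'.dirDeriv (m := ∞) (by simp) v).differentiable (by simp))]
    simp only [hDD]
    rw [hwave' z, Complex.re_sum]
  have hw0 : ∀ x, w (x, 0) = 0 := fun x => by simp [hw, hw', hc]
  have hw1 : ∀ x, dirDeriv timeVec w (x, 0) = ψ x := fun x => by
    have h3 : G (x, 0) = 2 * ψ x := coneFourier_zero_time φ x
    rw [hDw, h1]
    simp [hc, timeVec, h3]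
  obtain ⟨R, hR⟩ := hψc.isCompact.isBounded.subset_closedBall 0
  -- The Fourier formula does not show compact support; finite propagation speed supplies it.
  have hsupp : ∀ x t, R + |t| < ‖x‖ → w (x, t) = 0 := fun x t hx => by
    refine eq_zero_of_lt_norm hws hwave hw0 (R := R) (fun y hy => ?_) hx
    rw [hw1]
    by_contra hne
    have := hR (subset_tsupport ψ hne)
    rw [mem_closedBall_zero_iff] at this
    linarith
  refine ⟨fun z => w (z + (0, -t₀)), hws.comp (contDiff_id.add contDiff_const), fun z => ?_,
    fun T => ⟨R + (T + |t₀|), fun x t ht hx => ?_⟩, fun x => ?_, fun x => ?_⟩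
  · simp only [dirDeriv_translate]
    exact hwave _
  · simp only [Prod.mk_add_mk, add_zero]
    refine hsupp _ _ (lt_of_le_of_lt ?_ hx)
    have := abs_add_le t (-t₀)
    rw [abs_neg] at this
    linarith
  · simp [hw0]
  · simp only [dirDeriv_translate]
    simp [hw1]

end Existence

/-! ### Propagation of convergence along the wave equation -/

section Propagation

variable {𝕜 : Type*} [RCLike 𝕜] {d : ℕ}

/-- The wave operator. -/
def waveOp (f : Rd d × ℝ → 𝕜) (z : Rd d × ℝ) : 𝕜 :=
  dirDeriv timeVec (dirDeriv timeVec f) z - ∑ i, dirDeriv (spaceVec i) (dirDeriv (spaceVec i) f) z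

/-- Green's identity for the wave operator. -/
lemma hasDerivAt_green {W : Rd d × ℝ → ℝ} (hW : ContDiff ℝ ∞ W) (hwave : SolvesWave W)
    (hWc : SpatiallyCompact W) {f : Rd d × ℝ → 𝕜} (hf : ContDiff ℝ ∞ f) (t : ℝ) :
    HasDerivAt (fun s => ∫ x, (W (x, s) • dirDeriv timeVec f (x, s) -
      dirDeriv timeVec W (x, s) • f (x, s))) (∫ x, W (x, t) • waveOp f (x, t)) t := by
  have hDW : ∀ v, ContDiff ℝ ∞ (dirDeriv v W) := fun v => hW.dirDeriv (by simp) v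
  have hDf : ∀ v, ContDiff ℝ ∞ (dirDeriv v f) := fun v => hf.dirDeriv (by simp) v
  have hdW : Differentiable ℝ W := hW.differentiable (by simp)
  have hdf : Differentiable ℝ f := hf.differentiable (by simp)
  have hdDW : ∀ v, Differentiable ℝ (dirDeriv v W) := fun v => (hDW v).differentiable (by simp)
  have hdDf : ∀ v, Differentiable ℝ (dirDeriv v f) := fun v => (hDf v).differentiable (by simp)
  -- One expression serves as the density (`v` the time direction) and as the fluxes (`v` spatial).
  -- In its `v`-derivative the products of first derivatives cancel.
  have hs : ∀ v, ContDiff ℝ ∞ fun z => W z • dirDeriv v f z - dirDeriv v W z • f z := fun v =>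
    (hW.smul (hDf v)).sub ((hDW v).smul hf)
  have hc : ∀ v, SpatiallyCompact fun z => W z • dirDeriv v f z - dirDeriv v W z • f z := fun v =>
    (hWc.mono fun z hz => by simp [hz]).sub ((hWc.dirDeriv v).mono fun z hz => by simp [hz])
  have key := hasDerivAt_integral_slice_flux ((hs timeVec).of_le (by simp)) (hc timeVec)
    (fun i => (hs (spaceVec i)).of_le (by simp)) (fun i => hc (spaceVec i)) t
  have hz : ∀ v z, dirDeriv v (fun z => W z • dirDeriv v f z - dirDeriv v W z • f z) z =
      W z • dirDeriv v (dirDeriv v f) z - dirDeriv v (dirDeriv v W) z • f z := fun v z => by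
    rw [dirDeriv_sub v ((hdW z).fun_smul (hdDf v z)) ((hdDW v z).fun_smul (hdf z)),
      dirDeriv_smul v (hdW z) (hdDf v z), dirDeriv_smul v (hdDW v z) (hdf z)]
    module
  simp only [hz] at key
  have hop : ∀ z, W z • waveOp f z = W z • dirDeriv timeVec (dirDeriv timeVec f) z -
      dirDeriv timeVec (dirDeriv timeVec W) z • f z -
      ∑ i, (W z • dirDeriv (spaceVec i) (dirDeriv (spaceVec i) f) z -
        dirDeriv (spaceVec i) (dirDeriv (spaceVec i) W) z • f z) := fun z => by
    rw [hwave, waveOp, Finset.sum_sub_distrib, Finset.sum_smul, smul_sub, Finset.smul_sum]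
    abel
  simp only [hop]
  exact key

/-- A quantitative form of Green's identity. -/
lemma exists_green_bound {W : Rd d × ℝ → ℝ} (hW : ContDiff ℝ ∞ W) (hwave : SolvesWave W)
    (hWc : SpatiallyCompact W) (a b : ℝ) :
    ∃ C : ℝ, ∃ K : Set (Rd d × ℝ), IsCompact K ∧ ∀ (f : Rd d × ℝ → 𝕜) (M : ℝ), ContDiff ℝ ∞ f →
      (∀ z ∈ K, ‖waveOp f z‖ ≤ M) →
      ‖(∫ x, (W (x, b) • dirDeriv timeVec f (x, b) - dirDeriv timeVec W (x, b) • f (x, b))) -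
        ∫ x, (W (x, a) • dirDeriv timeVec f (x, a) - dirDeriv timeVec W (x, a) • f (x, a))‖
        ≤ C * M := by
  obtain ⟨R, hR⟩ := hWc (max |a| |b|)
  have hK : IsCompact (Metric.closedBall (0 : Rd d) R ×ˢ uIcc a b) :=
    (isCompact_closedBall _ _).prod isCompact_uIcc
  obtain ⟨N, hN⟩ := hK.exists_bound_of_continuousOn hW.continuous.continuousOn
  -- The constant and the compact set depend only on `W`, `a` and `b`, so the bound is uniform over
  -- a net of functions `f`.
  refine ⟨N * volume.real (Metric.closedBall (0 : Rd d) R) * ‖b - a‖, _, hK,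
    fun f M hf hM => ?_⟩
  have hmv := (convex_uIcc a b).norm_image_sub_le_of_norm_hasDerivWithin_le
    (C := N * M * volume.real (Metric.closedBall (0 : Rd d) R))
    (fun s _ => (hasDerivAt_green hW hwave hWc hf s).hasDerivWithinAt)
    (fun s hs => ?_) left_mem_uIcc right_mem_uIcc
  · exact hmv.trans (le_of_eq (by ring))
  · have hs' : |s| ≤ max |a| |b| := by
      rcases le_total a b with h | h
      · rw [uIcc_of_le h] at hs
        exact abs_le_max_abs_abs hs.1 hs.2
      · rw [uIcc_of_ge h] at hs
        rw [max_comm]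
        exact abs_le_max_abs_abs hs.1 hs.2
    rw [← setIntegral_eq_integral_of_forall_compl_eq_zero
      (s := Metric.closedBall (0 : Rd d) R) fun x hx => by
        rw [hR x s hs' (by simpa using hx), zero_smul]]
    refine norm_setIntegral_le_of_norm_le_const
      (isCompact_closedBall (0 : Rd d) R).measure_lt_top fun x hx => ?_
    rw [norm_smul]
    exact mul_le_mul (hN (x, s) ⟨hx, hs⟩) (hM (x, s) ⟨hx, hs⟩) (norm_nonneg _)
      ((norm_nonneg _).trans (hN (x, s) ⟨hx, hs⟩))

/-- A smooth compactly supported function as a test function on the whole space. -/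
def testFunction {ψ : Rd d → ℝ} (hψ : ContDiff ℝ ∞ ψ) (hψc : HasCompactSupport ψ) :
    TestFunction (⊤ : Opens (Rd d)) ℝ ⊤ :=
  ⟨ψ, hψ, hψc, by simp⟩

lemma scale_nonneg (r : ℝ≥0) (ε : Param) : 0 ≤ scale r ε := Real.rpow_nonneg ε.2.1.le _

lemma scale_le_one (r : ℝ≥0) (ε : Param) : scale r ε ≤ 1 :=
  Real.rpow_le_one ε.2.1.le ε.2.2 r.2

lemma tendsto_scale_smul_zero {v : Param → 𝕜} (r : ℝ≥0) (hv : Tendsto v atBot (𝓝 0)) :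
    Tendsto (fun ε => scale r ε • v ε) atBot (𝓝 0) := by
  refine squeeze_zero_norm (fun ε => ?_) (tendsto_zero_iff_norm_tendsto_zero.1 hv)
  rw [norm_smul, Real.norm_of_nonneg (scale_nonneg r ε)]
  exact mul_le_of_le_one_left (norm_nonneg _) (scale_le_one r ε)

/-! ### Negligible nets and regular exponents -/

namespace SolidPair

variable {P : SolidPair 𝕜}

/-- A net in `|I|`, viewed as functions constant in `x`, is negligible; testing it on a bump of
integral one recovers the net. Distributional smallness thus gives smallness of every seminorm of a
negligible net. -/
lemma tendsto_absI (hnull : ∀ V : Opens (Rd d), ∀ v : P.moderate V, v ∈ P.negligible V →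
    TendstoDistr V (v : Param → Rd d → 𝕜) 0) {b : Param → ℝ} (hb : b ∈ P.absI) :
    Tendsto b atBot (𝓝 0) := by
  have hb0 : ∀ ε, 0 ≤ b ε := absA_nonneg (absI_subset hb)
  have hle : ∀ (K : Set (Rd d)) l ε,
      ckSeminorm (⊤ : Opens (Rd d)) K l (fun _ => (b ε : 𝕜)) ≤ b ε := fun K l ε =>
    (ckSeminorm_const_le _).trans (by rw [RCLike.norm_ofReal, abs_of_nonneg (hb0 ε)])
  let v : P.moderate (⊤ : Opens (Rd d)) := ⟨fun ε _ => (b ε : 𝕜), fun ε => contDiffOn_const,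
    fun K _ _ l => absA_mono (absI_subset hb) (fun _ => ckSeminorm_nonneg) (hle K l)⟩
  have hv : v ∈ P.negligible ⊤ := fun K _ _ l =>
    absI_mono hb (fun _ => ckSeminorm_nonneg) (hle K l)
  let β : ContDiffBump (0 : Rd d) := default
  have hlim := hnull ⊤ v hv (testFunction (ψ := β.normed volume) β.contDiff_normed
    β.hasCompactSupport_normed)
  have he : ∀ ε, ∫ x, (testFunction (ψ := β.normed volume) β.contDiff_normed
      β.hasCompactSupport_normed) x • (v : Param → Rd d → 𝕜) ε x = (b ε : 𝕜) := fun ε => by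
    have : ∫ x, β.normed volume x • (b ε : 𝕜) = (b ε : 𝕜) := by
      rw [integral_smul_const, β.integral_normed, one_smul]
    exact this
  simp only [he] at hlim
  have := hlim.norm
  simpa [abs_of_nonneg (hb0 _)] using this

lemma contDiff_of_moderate {E : Type*} [NormedAddCommGroup E] [NormedSpace ℝ E]
    (f : P.moderate (⊤ : Opens E)) (ε : Param) : ContDiff ℝ ∞ ((f : Param → E → 𝕜) ε) := by
  have := f.2.1 ε
  rwa [Opens.coe_top, contDiffOn_univ] at this

lemma netDeriv_top (v : Rd d × ℝ) (f : P.moderate (⊤ : Opens (Rd d × ℝ))) (ε : Param) :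
    (netDeriv v f : Param → Rd d × ℝ → 𝕜) ε = dirDeriv v ((f : Param → Rd d × ℝ → 𝕜) ε) := by
  funext z
  simp [netDeriv, dirDeriv]

lemma cls_eq_cls {E : Type*} [NormedAddCommGroup E] [NormedSpace ℝ E] {Ω : Opens E}
    {f g : P.moderate Ω} : cls f = cls g ↔ f - g ∈ P.negligible Ω :=
  Ideal.Quotient.mk_eq_mk_iff_sub_mem f g

lemma cls_sum {E ι : Type*} [NormedAddCommGroup E] [NormedSpace ℝ E] {Ω : Opens E} (s : Finset ι)
    (f : ι → P.moderate Ω) : cls (∑ i ∈ s, f i) = ∑ i ∈ s, cls (f i) :=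
  map_sum (Ideal.Quotient.mk (P.negligible Ω)).toAddMonoidHom f s

/-- If `r` is a regular exponent at each point, then `ε^r v_ε` converges on each test function, for
any representative of the generalized function. -/
lemma exists_tendsto_of_regular (hnull : ∀ V : Opens (Rd d), ∀ v : P.moderate V,
    v ∈ P.negligible V → TendstoDistr V (v : Param → Rd d → 𝕜) 0) {r : ℝ≥0}
    (g : P.moderate (⊤ : Opens (Rd d))) (hr : ∀ x, r ∈ regularExponents (cls g) x)
    {ψ : Rd d → ℝ} (hψ : ContDiff ℝ ∞ ψ) (hψc : HasCompactSupport ψ) :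
    ∃ l, Tendsto (fun ε : Param => ∫ x, ψ x • (scale r ε • (g : Param → Rd d → 𝕜) ε x))
      atBot (𝓝 l) := by
  refine exists_tendsto_of_locally (fun ε x => scale r ε • (g : Param → Rd d → 𝕜) ε x)
    (fun ε => (contDiff_of_moderate g ε).continuous.const_smul _) (fun x => ?_) ψ hψ hψc
  obtain ⟨f, hf, V, hxV, -, T, hT⟩ := hr x
  refine ⟨V, hxV, fun χ => ⟨T χ, ?_⟩⟩
  -- The representative `f` may change with `x`; it differs from the fixed `g` by a negligible net,
  -- which does not affect the limit.
  have hneg := hnull ⊤ (g - f) (cls_eq_cls.1 hf.symm) (testFunction χ.contDiff χ.hasCompactSupport)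
  have hlim := (hT χ).add (tendsto_scale_smul_zero r hneg)
  rw [add_zero] at hlim
  refine hlim.congr fun ε => ?_
  have hint : ∀ h : P.moderate (⊤ : Opens (Rd d)),
      Integrable fun x => χ x • (h : Param → Rd d → 𝕜) ε x := fun h =>
    (χ.continuous.smul (contDiff_of_moderate h ε).continuous).integrable_of_hasCompactSupport
      (χ.hasCompactSupport.smul_right (f' := (h : Param → Rd d → 𝕜) ε))
  have e : ∀ h : P.moderate (⊤ : Opens (Rd d)),
      ∫ x, χ x • (scale r ε • (h : Param → Rd d → 𝕜) ε x) =
      scale r ε • ∫ x, χ x • (h : Param → Rd d → 𝕜) ε x := fun h => by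
    rw [← integral_smul]
    simp only [smul_comm (χ _) (scale r ε)]
  have e2 : ∫ x, (testFunction χ.contDiff χ.hasCompactSupport) x •
      ((g - f : P.moderate (⊤ : Opens (Rd d))) : Param → Rd d → 𝕜) ε x =
      (∫ x, χ x • (g : Param → Rd d → 𝕜) ε x) - ∫ x, χ x • (f : Param → Rd d → 𝕜) ε x := by
    rw [← integral_sub (hint g) (hint f)]
    simp only [← smul_sub]
    rfl
  rw [e2, e, e, smul_sub]
  abel

end SolidPair

end Propagation

end CEP

end

/-! ### Propagation of the singular spectrum -/

theorem mainTheorem9 {𝕜 : Type*} [RCLike 𝕜] (d : ℕ) (P : CEP.SolidPair 𝕜)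
    (hscale : ∀ r : ℝ≥0, (fun ε : CEP.Param => ((CEP.scale r ε : ℝ) : 𝕜)) ∈ P.A)
    (hnull : ∀ V : Opens (CEP.Rd d), ∀ v : P.moderate V, v ∈ P.negligible V →
      CEP.TendstoDistr V (v : CEP.Param → CEP.Rd d → 𝕜) 0)
    (u₀ u₁ : P.GenFun (⊤ : Opens (CEP.Rd d)))
    (u : P.GenFun (⊤ : Opens (CEP.Rd d × ℝ)))
    (hu : CEP.SolidPair.IsWaveSolution u u₀ u₁)
    (I : Set ℝ≥0)
    (hI : I = ∅ ∨ (∃ r : ℝ≥0∞, I = {s : ℝ≥0 | (s : ℝ≥0∞) < r}) ∨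
      ∃ r : ℝ≥0∞, I = {s : ℝ≥0 | (s : ℝ≥0∞) ≤ r})
    (h₀ : CEP.SolidPair.singularSpectrum u₀ ⊆ Set.univ ×ˢ I)
    (h₁ : CEP.SolidPair.singularSpectrum u₁ ⊆ Set.univ ×ˢ I)
    (t : ℝ) :
    CEP.SolidPair.singularSpectrum (CEP.SolidPair.slice t u) ⊆ Set.univ ×ˢ I := by
  open CEP CEP.SolidPair in
  obtain ⟨f, rfl⟩ : ∃ f : P.moderate ⊤, cls f = u := Ideal.Quotient.mk_surjective u
  rintro ⟨x₀, r⟩ ⟨-, hsing⟩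
  refine ⟨mem_univ _, ?_⟩
  by_contra hrI
  refine hsing ?_
  -- Since `r ∉ I`, no point `(x, r)` lies in either initial spectrum, so `r` is regular everywhere.
  have hreg : ∀ v : P.GenFun (⊤ : Opens (Rd d)), singularSpectrum v ⊆ Set.univ ×ˢ I →
      ∀ x, r ∈ regularExponents v x := fun v hv x => by
    by_contra hx
    exact hrI (hv (show (x, r) ∈ singularSpectrum v from ⟨trivial, hx⟩)).2
  have hr₀ := hreg _ h₀
  have hr₁ := hreg _ h₁
  rw [← hu.init, slice_cls] at hr₀
  rw [← hu.init_deriv, pderiv_cls, slice_cls] at hr₁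
  set n : P.moderate (⊤ : Opens (Rd d × ℝ)) := netDeriv (0, 1) (netDeriv (0, 1) f) -
    ∑ i : Fin d, netDeriv (EuclideanSpace.single i 1, 0)
      (netDeriv (EuclideanSpace.single i 1, 0) f) with hn
  have hneg : n ∈ P.negligible ⊤ := by
    have h : cls n = cls (netDeriv (0, 1) (netDeriv (0, 1) f)) -
        cls (∑ i : Fin d, netDeriv (EuclideanSpace.single i 1, 0)
          (netDeriv (EuclideanSpace.single i 1, 0) f)) := rfl
    rw [cls_sum] at h
    exact Ideal.Quotient.eq_zero_iff_mem.1 (h.trans hu.wave)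
  have hnval : ∀ ε, (n : Param → Rd d × ℝ → 𝕜) ε =
      waveOp ((f : Param → Rd d × ℝ → 𝕜) ε) := fun ε => by
    funext z
    have e : (n : Param → Rd d × ℝ → 𝕜) =
        (netDeriv (0, 1) (netDeriv (0, 1) f) : Param → Rd d × ℝ → 𝕜) -
        ∑ i : Fin d, (netDeriv (EuclideanSpace.single i 1, 0)
          (netDeriv (EuclideanSpace.single i 1, 0) f) : Param → Rd d × ℝ → 𝕜) := by
      simp [hn]
    rw [e]
    simp only [Pi.sub_apply, Finset.sum_apply, netDeriv_top]
    rfl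
  have hfs := contDiff_of_moderate f
  -- The neighbourhood of `x₀` can be all of space, since convergence holds globally.
  refine ⟨netSlice t f, (slice_cls t f).symm, ⊤, trivial, le_rfl, ?_⟩
  refine exists_tendstoDistr _ _
    (fun ε => (contDiff_of_moderate (netSlice t f) ε).continuous.const_smul _) fun ψ => ?_
  obtain ⟨W, hW, hwave, hWc, hW0, hW1⟩ := exists_solvesWave ψ.contDiff ψ.hasCompactSupport t
  obtain ⟨C, K, hK, hbound⟩ := exists_green_bound (𝕜 := 𝕜) hW hwave hWc 0 t
  have hslice : ∀ {F : Rd d × ℝ → ℝ}, ContDiff ℝ ∞ F → ContDiff ℝ ∞ fun x => F (x, 0) :=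
    fun hF => hF.comp (contDiff_id.prodMk contDiff_const)
  have hDW : ContDiff ℝ ∞ (dirDeriv timeVec W) := hW.dirDeriv (by simp) _
  obtain ⟨l₁, hl₁⟩ := exists_tendsto_of_regular hnull _ hr₁ (hslice hW)
    (hWc.hasCompactSupport_slice 0)
  obtain ⟨l₀, hl₀⟩ := exists_tendsto_of_regular hnull _ hr₀ (hslice hDW)
    ((hWc.dirDeriv timeVec).hasCompactSupport_slice 0)
  set B : Param → ℝ → 𝕜 := fun ε s => ∫ x, (W (x, s) •
    dirDeriv timeVec ((f : Param → Rd d × ℝ → 𝕜) ε) (x, s) -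
      dirDeriv timeVec W (x, s) • (f : Param → Rd d × ℝ → 𝕜) ε (x, s)) with hB
  have hb : Tendsto (fun ε => ckSeminorm ⊤ K 0 ((n : Param → Rd d × ℝ → 𝕜) ε)) atBot (𝓝 0) :=
    tendsto_absI hnull (hneg K hK (by simp) 0)
  -- The sup over `K` of the wave operator applied to `f ε` is controlled by the order-zero seminorm
  -- of the negligible net `n`.
  have hdiff : Tendsto (fun ε => B ε t - B ε 0) atBot (𝓝 0) := by
    refine squeeze_zero_norm (a := fun ε => C * ckSeminorm ⊤ K 0 ((n : Param → Rd d × ℝ → 𝕜) ε))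
      (fun ε => hbound _ _ (hfs ε) fun z hz => ?_) (by simpa using hb.const_mul C)
    rw [← hnval]
    have := le_ckSeminorm (n.2.1 ε) hK (by simp) hz (le_refl 0)
    rwa [norm_iteratedFDerivWithin_zero] at this
  -- Solving `B ε t - B ε 0` for `∫ ψ f_ε(·, t)` gives the pairing with `u₀`, minus the pairing with
  -- `u₁`, minus this vanishing difference.
  have hlim := (hl₀.sub hl₁).sub (tendsto_scale_smul_zero r hdiff)
  refine ⟨_, hlim.congr fun ε => ?_⟩
  have hi₁ := SpatiallyCompact.integrable_slice (F := fun z => W z •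
    dirDeriv timeVec ((f : Param → Rd d × ℝ → 𝕜) ε) z) (hWc.mono fun z hz => by simp [hz])
    (hW.continuous.smul ((hfs ε).dirDeriv (m := ∞) (by simp) _).continuous) 0
  have hi₀ := SpatiallyCompact.integrable_slice (F := fun z => dirDeriv timeVec W z •
    (f : Param → Rd d × ℝ → 𝕜) ε z) ((hWc.dirDeriv timeVec).mono fun z hz => by simp [hz])
    (hDW.continuous.smul (hfs ε).continuous) 0
  have hBt : B ε t = -∫ x, ψ x • (f : Param → Rd d × ℝ → 𝕜) ε (x, t) := by
    rw [← integral_neg]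
    simp [hB, hW0, hW1]
  have hB0 : B ε 0 = (∫ x, W (x, 0) • dirDeriv timeVec ((f : Param → Rd d × ℝ → 𝕜) ε) (x, 0)) -
      ∫ x, dirDeriv timeVec W (x, 0) • (f : Param → Rd d × ℝ → 𝕜) ε (x, 0) :=
    integral_sub hi₁ hi₀
  have hpull : ∀ (χ : Rd d → ℝ) (g : Rd d → 𝕜), ∫ x, χ x • (scale r ε • g x) =
      scale r ε • ∫ x, χ x • g x := fun χ g => by
    rw [← integral_smul]
    simp only [smul_comm (χ _) (scale r ε)]
  have e₁ : ∀ x, (netSlice 0 (netDeriv (0, 1) f) : Param → Rd d → 𝕜) ε x =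
      dirDeriv timeVec ((f : Param → Rd d × ℝ → 𝕜) ε) (x, 0) := fun x =>
    congrFun (netDeriv_top (0, 1) f ε) (x, 0)
  have e₀ : ∀ s x, (netSlice s f : Param → Rd d → 𝕜) ε x =
      (f : Param → Rd d × ℝ → 𝕜) ε (x, s) := fun s x => rfl
  simp only [hpull, e₁, e₀]
  rw [hBt, hB0, ← smul_sub, ← smul_sub]
  congr 1
  abel
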